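/- Strings are finite binary strings. For a partial computable function $U$ from strings to strings (a machine) put $\mathrm{KS}_U(x)=\min\{|p| : U(p)=x\}$, with $\mathrm{KS}_U(x)=\infty$ if $x$ has no description, i.e. no $p$ with $U(p)=x$. The machine $U$ is prefix-free if its domain does not contain both a string and a proper extension of it. It is prefix-stable if, whenever $U(p)$ is defined, $U(p')$ is defined and equal to $U(p)$ for every extension $p'$ of $p$. Let $M$ be the class of all prefix-free machines or the class of all prefix-stable machines. A machine $U\in M$ is optimal in $M$ if for every $V\in M$ there is a constant $c$ such that $\mathrm{KS}_U(x)\le\mathrm{KS}_V(x)+c$ for all strings $x$. It is universal in $M$ if for every $V\in M$ there is a string $v$ such that for all $x$ the values $U(vx)$ and $V(x)$ are both undefined or both defined and equal. A function $K$ on strings is upper semicomputable if it is the pointwise limit of a uniformly computable non-increasing sequence of total functions $K_n$ (taking values in the same set as $K$). Let $\mathcal C$ be the class of upper semicomputable functions $K$ from strings to $\mathbb N\cup\{\infty\}$ with $\sum_x 2^{-K(x)}\le 1$, where $2^{-\infty}=0$. (a) The class of functions $\mathrm{KS}_U$ for all prefix-stable $U$ and the class of functions $\mathrm{KS}_U$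 for all prefix-free $U$ both coincide with $\mathcal C$. Likewise, the class of everywhere finite functions $\mathrm{KS}_U$ for prefix-stable $U$ and the class of everywhere finite functions $\mathrm{KS}_U$ for prefix-free $U$ both coincide with the class of upper semicomputable functions $K$ from strings to $\mathbb Z$ with $\sum_x 2^{-K(x)}\le 1$. (b) The class of functions $\mathrm{KS}_U$ for $U$ universal among prefix-free machines coincides with the class of functions $\mathrm{KS}_U$ for $U$ optimal among prefix-free machines. The same holds with prefix-stable in place of prefix-free. Each of these classes consists exactly of those $K\in\mathcal C$ that are minimal up to $O(1)$, i.e. such that for every $K'\in\mathcal C$ there is a constant $c$ with $K(x)\le K'(x)+c$ for all $x$. Moreover, if $U$ is optimal among prefix-stable machines, then some string $x$ has two incomparable (neither is a prefix of the other) prefix-minimal descriptions, i.e. descriptions of $x$ none of whose proper prefixes is a description of $x$. -/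

import Mathlib

open Filter Topology
open scoped ENNReal

namespace PrefixComplexity

/-- Binary strings. -/
abbrev Str : Type := List Bool

/-- A machine (decompressor) is a partial function from strings to strings; computability is
imposed in the classes of machines below. -/
abbrev Machine : Type := Str →. Str

/-- The complexity of `x` with respect to `U`: the minimal length of a description of `x`,
and `⊤` if `x` has no description. -/
noncomputable def KS (U : Machine) (x : Str) : ℕ∞ :=
  ⨅ (p : Str) (_ : x ∈ U p), (p.length : ℕ∞)

/-- Partial computable machines whose domain does not contain a string and a proper extension
of it. -/
def PrefixFree (U : Machine) : Prop :=
  Partrec U ∧ ∀ p q : Str, (U p).Dom → (U q).Dom → p <+: q → p = q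

/-- Partial computable machines such that, if `U p` is defined, then `U` is defined and has the
same value on all extensions of `p`. -/
def PrefixStable (U : Machine) : Prop :=
  Partrec U ∧ ∀ p q x : Str, x ∈ U p → p <+: q → x ∈ U q

/-- `U` is optimal in the class `M` of machines. -/
def Optimal (M : Machine → Prop) (U : Machine) : Prop :=
  M U ∧ ∀ V : Machine, M V → ∃ c : ℕ, ∀ x : Str, KS U x ≤ KS V x + c

/-- `U` is universal in the class `M` of machines. Equality in `Part` means that both sides are
defined simultaneously and are then equal. -/
def Universal (M : Machine → Prop) (U : Machine) : Prop :=
  M U ∧ ∀ V : Machine, M V → ∃ v : Str, ∀ x : Str, U (v ++ x) = V x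

/-- The complexity functions of the machines satisfying `M`. -/
def complexities (M : Machine → Prop) : Set (Str → ℕ∞) :=
  {K | ∃ U : Machine, M U ∧ KS U = K}

/-- `ℕ∞` as a type of finite objects, `⊤` being coded as one more value. -/
instance instPrimcodableENat : Primcodable ℕ∞ :=
  inferInstanceAs (Primcodable (Option ℕ))

/-- `K` is the pointwise limit of a uniformly computable (non-strictly) decreasing sequence of
total functions with values in `α`. It is used for `α = ℤ` and for `α = ℕ∞`. -/
def UpperSemicomputable {α : Type} [Primcodable α] [Preorder α] [TopologicalSpace α]
    (K : Str → α) : Prop :=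
  ∃ k : ℕ → Str → α, Computable₂ k ∧ (∀ x, Antitone fun n => k n x) ∧
    ∀ x, Tendsto (fun n => k n x) atTop (𝓝 (K x))

open Classical in
/-- `2 ^ (-k)`, where `2 ^ (-⊤) = 0`. -/
noncomputable def weight (k : ℕ∞) : ℝ≥0∞ :=
  if k = ⊤ then 0 else (2 : ℝ≥0∞)⁻¹ ^ k.toNat

/-- Upper semicomputable functions with values in `ℕ ∪ {∞}` such that `∑ₓ 2 ^ (-K x) ≤ 1`. -/
def semimeasureClass : Set (Str → ℕ∞) :=
  {K | UpperSemicomputable K ∧ ∑' x, weight (K x) ≤ 1}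

/-- Upper semicomputable functions with (finite) integer values such that
`∑ₓ 2 ^ (-K x) ≤ 1`. -/
def intSemimeasureClass : Set (Str → ℤ) :=
  {K | UpperSemicomputable K ∧ ∑' x, (2 : ℝ≥0∞) ^ (-K x) ≤ 1}

/-- The integer-valued complexity functions of the machines satisfying `M`, that is, those of the
machines for which every string has a description. -/
def intComplexities (M : Machine → Prop) : Set (Str → ℤ) :=
  {K | ∃ U : Machine, M U ∧
    ∀ x, IsLeast {n : ℤ | ∃ p : Str, x ∈ U p ∧ (p.length : ℤ) = n} (K x)}

/-- The functions in the class `C` that are minimal in `C` up to an additive constant. -/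
def minimalFunctions (C : Set (Str → ℕ∞)) : Set (Str → ℕ∞) :=
  {K | K ∈ C ∧ ∀ K' ∈ C, ∃ c : ℕ, ∀ x : Str, K x ≤ K' x + c}

/-- `p` is a prefix-minimal description of `x`: it is a description of `x`, and `U` is undefined
on all its proper prefixes. -/
def IsMinimalDescription (U : Machine) (p x : Str) : Prop :=
  x ∈ U p ∧ ∀ q : Str, q <+: p → (U q).Dom → q = p

end PrefixComplexity

namespace PrefixComplexity

/-! Every `KS U` lies in the class: a dovetailed enumeration of the graph of `U` gives upper bounds
converging to `KS U`, and shortest descriptions of distinct objects are incomparable in both kinds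
of machine, so the Kraft inequality applies (`KS_mem_semimeasureClass`).

Conversely, the online Kraft-Chaitin allocation (`allocation_spec`) turns a computable stream of
requests `(x, k)` of total size at most `1` into a machine. The difficulty is to obtain `K` exactly,
with no additive constant, although an approximation from above also requests obsolete values.
`exists_requests` splits non-uniformly. If the sum of weights is below `1`, starting the
approximation late makes finitely many strings final and leaves the others a tail so small that
doubling it by obsolete values is harmless. If the sum is `1`, then `m` is known to be the final
value of `x` as soon as the visible sum exceeds `1 - 2 ^ (-m)`, since any decrease would push the
sum above `1`; so only true values are requested.

For (b), universal machines are optimal, and optimal ones have minimal complexity by (a). A minimal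
`K` must have sum strictly below `1` (`tsum_weight_lt_one`): otherwise one could compute strings `x
n` with `K (x n) > 2 * n + 2`, although `x n` has complexity at most `n + O(1)`. The gap pays for
one more incomparable string `v`, as long as desired. A universal machine is placed in the cone of
`v` and exact descriptions for `K` outside it; for long `v` the cone does not lower the complexity
(`exists_universal`).

For the last claim, one searches for distinct `x`, `z` with descriptions `p`, `q` sharing their
first `2 * n + 2` bits. The `x` found has complexity at most `n + O(1)`, hence for suitable `n` a
description of at most `2 * n + 2` bits. If its minimal prefix were also the minimal prefix of `p`,
it would be a prefix of `q`, and stability would make `q` describe `x`.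

Both kinds of machine are handled at once through a Boolean parameter and consistent enumerations of
pairs (description, object). -/

/-! ### Negative powers of two -/

/-- `2 ^ (-n)`. -/
noncomputable def mass (n : ℕ) : ℝ≥0∞ := (2 : ℝ≥0∞)⁻¹ ^ n

@[simp] theorem mass_zero : mass 0 = 1 := by simp [mass]

theorem mass_succ_add_self (n : ℕ) : mass (n + 1) + mass (n + 1) = mass n := by
  simp only [mass, pow_succ, ← mul_add, ENNReal.inv_two_add_inv_two, mul_one]

theorem mass_add (m n : ℕ) : mass (m + n) = mass m * mass n := pow_add _ _ _

theorem mass_ne_zero (n : ℕ) : mass n ≠ 0 := by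
  simp [mass]

theorem mass_ne_top (n : ℕ) : mass n ≠ ∞ := by
  simp [mass]

theorem mass_antitone : Antitone mass :=
  antitone_nat_of_succ_le fun n => by rw [← mass_succ_add_self n]; exact le_self_add

theorem tsum_mass_succ : ∑' n, mass (n + 1) = 1 := by
  simp only [mass]
  exact ENNReal.tsum_two_zpow_neg_add_one ▸ tsum_congr fun n => by
    rw [show (-1 - n : ℤ) = -((n + 1 : ℕ) : ℤ) by push_cast; ring, ENNReal.zpow_neg, zpow_natCast,
      ENNReal.inv_pow]

theorem exists_mass_lt {ε : ℝ≥0∞} (h : ε ≠ 0) : ∃ n, mass n < ε :=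
  ENNReal.exists_inv_two_pow_lt h

theorem exists_mass_add_le {s : ℝ≥0∞} (h : s < 1) (c : ℕ) : ∃ d ≥ c, s + mass d ≤ 1 := by
  obtain ⟨n, hn⟩ := exists_mass_lt (tsub_pos_of_lt h).ne'
  refine ⟨max c n, le_max_left _ _, ?_⟩
  calc s + mass (max c n) ≤ s + (1 - s) :=
        add_le_add le_rfl ((mass_antitone (le_max_right _ _)).trans hn.le)
    _ = 1 := add_tsub_cancel_of_le h.le

/-! ### Prefix-free codes and the Kraft inequality -/

/-- Induction on the maximal length. If no codeword is empty, removing the first bit splits the code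
into two shorter codes, each of which contributes at most one half. -/
theorem kraft_finset {ι : Type*} (N : ℕ) : ∀ (s : Finset ι) (p : ι → Str),
    (∀ i ∈ s, ∀ j ∈ s, p i <+: p j → i = j) → (∀ i ∈ s, (p i).length ≤ N) →
    ∑ i ∈ s, mass (p i).length ≤ 1 := by
  classical
  induction N with
  | zero =>
    intro s p hp hN
    have : s.card ≤ 1 := Finset.card_le_one.2 fun i hi j hj =>
      hp i hi j hj (by rw [List.length_eq_zero_iff.1 (Nat.le_zero.1 (hN i hi))]; simp)
    calc ∑ i ∈ s, mass (p i).length ≤ ∑ i ∈ s, 1 :=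
          Finset.sum_le_sum fun i _ => mass_zero ▸ mass_antitone (Nat.zero_le _)
      _ ≤ 1 := by simpa using this
  | succ N ih =>
    intro s p hp hN
    by_cases h : ∃ i ∈ s, p i = []
    · obtain ⟨i, hi, h0⟩ := h
      have : s = {i} := Finset.eq_singleton_iff_unique_mem.2
        ⟨hi, fun j hj => (hp i hi j hj (by simp [h0])).symm⟩
      simp [this, h0]
    · push Not at h
      have key (c : Bool) : ∑ i ∈ s with (p i).head? = some c, mass (p i).length ≤ mass 1 := by
        have hc : ∀ i ∈ s.filter (fun i => (p i).head? = some c), p i = c :: (p i).tail := by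
          intro i hi
          obtain ⟨-, hh⟩ := Finset.mem_filter.1 hi
          exact (List.cons_head?_tail hh).symm
        have hsum : ∑ i ∈ s with (p i).head? = some c, mass (p i).length =
            mass 1 * ∑ i ∈ s with (p i).head? = some c, mass (p i).tail.length := by
          rw [Finset.mul_sum]
          refine Finset.sum_congr rfl fun i hi => ?_
          conv_lhs => rw [hc i hi, List.length_cons, Nat.add_comm, mass_add]
        rw [hsum]
        refine mul_le_of_le_one_right' (ih _ _ (fun i hi j hj hij => ?_) fun i hi => ?_)
        · refine hp i (Finset.mem_filter.1 hi).1 j (Finset.mem_filter.1 hj).1 ?_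
          rw [hc i hi, hc j hj]
          exact (List.prefix_cons_inj c).2 hij
        · have := hN i (Finset.mem_filter.1 hi).1
          rw [List.length_tail]; omega
      have hu : s = s.filter (fun i => (p i).head? = some false) ∪
          s.filter (fun i => (p i).head? = some true) := by
        ext i
        simp only [Finset.mem_union, Finset.mem_filter, ← and_or_left, iff_self_and]
        intro hi
        cases hpi : p i with
        | nil => exact absurd hpi (h i hi)
        | cons a t => cases a <;> simp
      calc ∑ i ∈ s, mass (p i).length ≤ _ := by
            conv_lhs => rw [hu]
            exact le_self_add.trans_eq Finset.sum_union_inter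
        _ ≤ mass 1 + mass 1 := add_le_add (key false) (key true)
        _ = 1 := by rw [← mass_zero]; exact mass_succ_add_self 0

/-- The Kraft inequality for prefix-free codes. -/
theorem tsum_mass_length_le_one {ι : Type*} (p : ι → Str) (hp : ∀ i j, p i <+: p j → i = j) :
    ∑' i, mass (p i).length ≤ 1 := by
  rw [ENNReal.tsum_eq_iSup_sum]
  exact iSup_le fun s => kraft_finset (s.sup fun i => (p i).length) s p
    (fun i _ j _ => hp i j) fun i hi => Finset.le_sup (f := fun i => (p i).length) hi

/-- Neither of two strings is a prefix of the other one. -/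
def Incomparable (p q : Str) : Prop := ¬ p <+: q ∧ ¬ q <+: p

theorem Incomparable.symm {p q : Str} (h : Incomparable p q) : Incomparable q p := And.symm h

theorem Incomparable.extend_right {p w w' : Str} (h : Incomparable p w) (hw : w <+: w') :
    Incomparable p w' :=
  ⟨fun h' => (List.prefix_or_prefix_of_prefix h' hw).elim h.1 h.2, fun h' => h.2 (hw.trans h')⟩

theorem Incomparable.extend_left {p p' w : Str} (h : Incomparable p w) (hp : p <+: p') :
    Incomparable p' w :=
  (h.symm.extend_right hp).symm

theorem Incomparable.append_left (w : Str) {p q : Str} (h : Incomparable p q) :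
    Incomparable (w ++ p) (w ++ q) := by
  simpa [Incomparable] using h

/-- The string `0 ... 01` with `n` zeros. -/
def unary (n : ℕ) : Str := List.replicate n false ++ [true]

@[simp] theorem length_unary (n : ℕ) : (unary n).length = n + 1 := by simp [unary]

theorem unary_succ (n : ℕ) : unary (n + 1) = false :: unary n := by
  simp [unary, List.replicate_succ]

/-- The first `true` marks where `unary m` ends, so these strings are self-delimiting and can serve
as machine numbers. -/
theorem unary_append_prefix {m n : ℕ} {s t : Str} (h : unary m ++ s <+: unary n ++ t) :
    m = n ∧ s <+: t := by
  induction m generalizing n with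
  | zero => cases n <;> simp_all [unary, List.replicate_succ]
  | succ m ih =>
    cases n with
    | zero => simp [unary, List.replicate_succ] at h
    | succ n =>
      rw [unary_succ, unary_succ, List.cons_append, List.cons_append,
        List.prefix_cons_inj] at h
      exact ⟨congrArg _ (ih h).1, (ih h).2⟩

theorem incomparable_unary {m n : ℕ} (h : m ≠ n) : Incomparable (unary m) (unary n) :=
  ⟨fun h' => h (unary_append_prefix (s := []) (t := []) (by simpa using h')).1,
    fun h' => h (unary_append_prefix (s := []) (t := []) (by simpa using h')).1.symm⟩

theorem incomparable_unary_replicate {m n : ℕ} (h : m < n) :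
    Incomparable (unary m) (List.replicate n false) := by
  have h1 : true ∈ unary m := by simp [unary]
  refine ⟨fun h' => by simpa using h'.subset h1, fun h' => ?_⟩
  have hl := h'.length_le
  have he := h'.eq_of_length (by simp at hl ⊢; omega)
  rw [← he] at h1
  simp at h1

/-! ### Allocation of incomparable strings of prescribed lengths

The free space is kept as a list of incomparable strings of strictly decreasing lengths. -/

/-- The string of length `k` allocated when the free space is `L`. -/
def alloc (k : ℕ) (L : List Str) : Option Str :=
  (L.filter fun w => w.length ≤ k).head?.map fun w => w ++ List.replicate (k - w.length) false

/-- The free space left in the cone of `w` when the leftmost string of length `k` is taken. -/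
def siblings (k : ℕ) (w : Str) : List Str :=
  (List.range (k - w.length)).map fun i => w ++ unary (k - w.length - 1 - i)

/-- The free space that `alloc k L` leaves. -/
def remaining (k : ℕ) (L : List Str) : List Str :=
  L.filter (fun w => k < w.length) ++
    (((L.filter fun w => w.length ≤ k).head?.map (siblings k)).getD [] ++
      (L.filter fun w => w.length ≤ k).tail)

/-- The free space after the first `n` requests. -/
def freeList (l : ℕ → Option ℕ) (n : ℕ) : List Str :=
  Nat.rec [[]] (fun i L => ((l i).map fun k => remaining k L).getD L) n

/-- The string allocated for the `n`-th request. -/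
def allocation (l : ℕ → Option ℕ) (n : ℕ) : Option Str :=
  (l n).bind fun k => alloc k (freeList l n)

theorem mem_siblings {k : ℕ} {w u : Str} :
    u ∈ siblings k w ↔ ∃ j, w.length + j < k ∧ u = w ++ unary j := by
  simp only [siblings, List.mem_map, List.mem_range]
  constructor
  · rintro ⟨i, hi, rfl⟩
    exact ⟨_, by omega, rfl⟩
  · rintro ⟨j, hj, rfl⟩
    exact ⟨k - w.length - 1 - j, by omega, by congr 2; omega⟩

theorem pairwise_siblings (k : ℕ) (w : Str) :
    (siblings k w).Pairwise fun u v => v.length < u.length ∧ Incomparable u v := by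
  rw [siblings, List.pairwise_map]
  refine List.pairwise_lt_range.imp_of_mem fun {i j} hi hj hij => ?_
  rw [List.mem_range] at hi hj
  refine ⟨by simp; omega, (incomparable_unary (by omega)).append_left w⟩

theorem sum_siblings {k : ℕ} {w : Str} (h : w.length ≤ k) :
    mass k + ((siblings k w).map fun u => mass u.length).sum = mass w.length := by
  obtain ⟨m, rfl⟩ := Nat.exists_eq_add_of_le h
  clear h
  simp only [siblings, List.map_map, Nat.add_sub_cancel_left]
  induction m with
  | zero => simp
  | succ m ih =>
    rw [List.range_succ_eq_map, List.map_cons, List.sum_cons, List.map_map, ← add_assoc]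
    have h1 : mass (w.length + (m + 1)) + mass (w.length + (m + 1)) = mass (w.length + m) :=
      mass_succ_add_self _
    convert ih using 2
    · rw [← h1]; simp
    · refine congrArg _ (List.map_congr_left fun i hi => ?_)
      simp only [Function.comp_apply, List.length_append, length_unary]
      congr 3; omega

/-- Distinct lengths in `(k, m]` weigh at most `2 ^ (-k) - 2 ^ (-m)`. The slack makes the bound
strict: free strings that are all too long for a request of length `k` cannot have total size `2 ^
(-k)`. -/
theorem sum_mass_add_le {k : ℕ} {L : List Str}
    (hL : L.Pairwise fun u v => v.length < u.length) (hk : ∀ w ∈ L, k < w.length) :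
    ∃ m, (L.map fun u => mass u.length).sum + mass m ≤ mass k := by
  -- The head is the longest string, so the induction hypothesis is needed with the smaller bound
  -- `w.length - 1`; hence `m` is generalised.
  suffices ∀ m, k ≤ m → (∀ w ∈ L, w.length ≤ m) →
      (L.map fun u => mass u.length).sum + mass m ≤ mass k by
    refine ⟨k + (L.map List.length).sum, this _ (Nat.le_add_right _ _) fun w hw => ?_⟩
    exact (List.single_le_sum (by simp) _ (List.mem_map_of_mem hw)).trans (Nat.le_add_left _ _)
  induction L with
  | nil => intro m hm _; simpa using mass_antitone hm
  | cons w L ih =>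
    intro m hm hmax
    rw [List.pairwise_cons] at hL
    have hw := hk w (by simp)
    have h1 := ih hL.2 (fun u hu => hk u (by simp [hu])) (w.length - 1) (by omega)
      fun u hu => by have := hL.1 u hu; omega
    rw [List.map_cons, List.sum_cons]
    calc mass w.length + (L.map fun u => mass u.length).sum + mass m
        ≤ mass w.length + (L.map fun u => mass u.length).sum + mass w.length := by
          gcongr; exact mass_antitone (hmax w (by simp))
      _ = (L.map fun u => mass u.length).sum + mass (w.length - 1) := by
          rw [← mass_succ_add_self (w.length - 1), Nat.sub_add_cancel (by omega)]; ring
      _ ≤ mass k := h1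

/-- The invariant of the free space. -/
def IsFree (L : List Str) : Prop :=
  L.Pairwise fun u v => v.length < u.length ∧ Incomparable u v

/-- The total size of the free space. -/
noncomputable def freeMass (L : List Str) : ℝ≥0∞ := (L.map fun u => mass u.length).sum

/-- Lengths decrease along `L`, so the first string of length at most `k` is the longest that fits.
Splitting its cone leaves one sibling of each length from `k` down to `w.length + 1`; these fall
between the longer strings `B` and the shorter strings `A'`, so lengths stay distinct. Some string
fits, because otherwise all are longer than `k` and `sum_mass_add_le` contradicts `hk`. -/
theorem alloc_spec {k : ℕ} {L : List Str} (hL : IsFree L) (hk : mass k ≤ freeMass L) :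
    ∃ w ∈ L, ∃ p, alloc k L = some p ∧ w <+: p ∧ p.length = k ∧ IsFree (remaining k L) ∧
      (∀ u ∈ remaining k L, (∃ v ∈ L, v <+: u) ∧ Incomparable p u) ∧
      mass k + freeMass (remaining k L) = freeMass L := by
  set A := L.filter fun w => w.length ≤ k with hA
  set B := L.filter fun w => k < w.length with hB
  have hperm : (A ++ B).Perm L := by
    have := List.filter_append_perm (fun w : Str => decide (w.length ≤ k)) L
    rwa [show (fun w : Str => !decide (w.length ≤ k)) = fun w => decide (k < w.length) by
      ext w; simp [← decide_not]] at this
  have hBk : ∀ w ∈ B, k < w.length := fun w hw => by simpa using (List.mem_filter.1 hw).2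
  have hAk : ∀ w ∈ A, w.length ≤ k := fun w hw => by simpa using (List.mem_filter.1 hw).2
  have hBL : ∀ w ∈ B, w ∈ L := fun w hw => (List.mem_filter.1 hw).1
  have hAL : ∀ w ∈ A, w ∈ L := fun w hw => (List.mem_filter.1 hw).1
  have hBf : IsFree B := hL.filter _
  have hAf : IsFree A := hL.filter _
  have hinc : ∀ u ∈ L, ∀ v ∈ L, u ≠ v → Incomparable u v := by
    intro u hu v hv huv
    have : Std.Symm Incomparable := ⟨fun _ _ h => h.symm⟩
    have h : L.Pairwise Incomparable := hL.imp fun h => h.2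
    exact h.forall hu hv huv
  have hsum : freeMass A + freeMass B = freeMass L := by
    rw [freeMass, freeMass, ← List.sum_append, ← List.map_append]
    exact (hperm.map _).sum_eq
  cases hc : A with
  | nil =>
    exfalso
    obtain ⟨m, hm⟩ := sum_mass_add_le (hBf.imp fun h => h.1) hBk
    have h0 : freeMass B = freeMass L := by rw [← hsum, hc]; simp [freeMass]
    change freeMass B + mass m ≤ mass k at hm
    rw [h0] at hm
    have hfin : freeMass L ≠ ∞ := ne_top_of_le_ne_top (mass_ne_top k) (le_self_add.trans hm)
    exact absurd (hm.trans hk) (not_le.2 (ENNReal.lt_add_right hfin (mass_ne_zero m)))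
  | cons w A' =>
    have hwA : w ∈ A := by simp [hc]
    have hAA : ∀ u ∈ A', u ∈ A := fun u hu => by simp [hc, hu]
    have hwk := hAk w hwA
    have hrem : remaining k L = B ++ (siblings k w ++ A') := by
      rw [remaining, ← hA, ← hB, hc]; simp
    rw [hc, IsFree, List.pairwise_cons] at hAf
    have hsib : ∀ u ∈ siblings k w, w <+: u ∧ w.length < u.length ∧ u.length ≤ k ∧
        Incomparable (w ++ List.replicate (k - w.length) false) u := by
      intro u hu
      obtain ⟨j, hj, rfl⟩ := mem_siblings.1 hu
      exact ⟨List.prefix_append _ _, by simp, by simp; omega,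
        ((incomparable_unary_replicate (by omega)).symm).append_left w⟩
    have hne : ∀ u ∈ L, u ≠ w → Incomparable (w ++ List.replicate (k - w.length) false) u :=
      fun u hu huw => (hinc w (hAL w hwA) u hu huw.symm).extend_left (List.prefix_append _ _)
    refine ⟨w, hAL w hwA, w ++ List.replicate (k - w.length) false, ?_, List.prefix_append _ _,
      by simp; omega, ?_, ?_, ?_⟩
    · rw [alloc, ← hA, hc]; simp
    · rw [hrem, IsFree, List.pairwise_append, List.pairwise_append]
      refine ⟨hBf, ⟨pairwise_siblings k w, hAf.2, fun u hu v hv => ?_⟩, fun u hu v hv => ?_⟩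
      · obtain ⟨h1, h2, -, -⟩ := hsib u hu
        obtain ⟨h3, h4⟩ := hAf.1 v hv
        exact ⟨h3.trans h2, h4.extend_left h1⟩
      · have hu' := hBk u hu
        rcases List.mem_append.1 hv with hv | hv
        · obtain ⟨h1, -, h3, -⟩ := hsib v hv
          refine ⟨by omega, (hinc u (hBL u hu) w (hAL w hwA) ?_).extend_right h1⟩
          rintro rfl; omega
        · have hv' := hAk v (hAA v hv)
          refine ⟨by omega, hinc u (hBL u hu) v (hAL v (hAA v hv)) ?_⟩
          rintro rfl; omega
    · intro u hu
      rw [hrem, List.mem_append, List.mem_append] at hu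
      rcases hu with hu | hu | hu
      · refine ⟨⟨u, hBL u hu, List.prefix_rfl⟩, hne u (hBL u hu) ?_⟩
        rintro rfl
        have := hBk u hu
        omega
      · exact ⟨⟨w, hAL w hwA, (hsib u hu).1⟩, (hsib u hu).2.2.2⟩
      · refine ⟨⟨u, hAL u (hAA u hu), List.prefix_rfl⟩, hne u (hAL u (hAA u hu)) ?_⟩
        rintro rfl
        exact absurd (hAf.1 u hu).1 (lt_irrefl _)
    · rw [← hsum, hrem, hc]
      have := sum_siblings hwk
      simp only [freeMass, List.map_append, List.sum_append, List.map_cons, List.sum_cons]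
      rw [← this]; ring

/-- `2 ^ (-k)` for the length `k` of a request, if there is one. -/
noncomputable def requestMass (o : Option ℕ) : ℝ≥0∞ := (o.map mass).getD 0

/-- Granted mass plus free mass is always `1`, so a request that keeps the total at most `1` fits.
New free strings extend old ones, which preserves incomparability with earlier allocations. -/
theorem freeList_spec {l : ℕ → Option ℕ} (hl : ∑' n, requestMass (l n) ≤ 1) (n : ℕ) :
    IsFree (freeList l n) ∧
      ∑ i ∈ Finset.range n, requestMass (l i) + freeMass (freeList l n) = 1 ∧
      ∀ i < n, ∀ p ∈ allocation l i, ∀ u ∈ freeList l n, Incomparable p u := by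
  induction n with
  | zero => simp [freeList, IsFree, freeMass]
  | succ n ih =>
    obtain ⟨h1, h2, h3⟩ := ih
    cases hn : l n with
    | none =>
      have hf : freeList l (n + 1) = freeList l n := by
        change ((l n).map fun k => remaining k (freeList l n)).getD (freeList l n) = _
        simp [hn]
      rw [hf, Finset.sum_range_succ, hn]
      refine ⟨h1, by simpa [requestMass] using h2, fun i hi p hp u hu => ?_⟩
      rcases Nat.lt_succ_iff_lt_or_eq.1 hi with hi | rfl
      · exact h3 i hi p hp u hu
      · simp [allocation, hn] at hp
    | some k =>
      have hf : freeList l (n + 1) = remaining k (freeList l n) := by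
        change ((l n).map fun k => remaining k (freeList l n)).getD (freeList l n) = _
        simp [hn]
      have hk : mass k ≤ freeMass (freeList l n) := by
        have h4 : ∑ i ∈ Finset.range (n + 1), requestMass (l i) ≤ 1 :=
          (ENNReal.sum_le_tsum _).trans hl
        rw [Finset.sum_range_succ, hn, ← h2] at h4
        refine (ENNReal.add_le_add_iff_left ?_).1 h4
        exact ne_top_of_le_ne_top ENNReal.one_ne_top (h2 ▸ le_self_add)
      obtain ⟨w, hw, q, hq, -, -, h5, h6, h7⟩ := alloc_spec h1 hk
      rw [hf, Finset.sum_range_succ, hn]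
      refine ⟨h5, ?_, fun i hi p hp u hu => ?_⟩
      · rw [← h2, ← h7, ← add_assoc]; rfl
      · obtain ⟨⟨v, hv, hvu⟩, h8⟩ := h6 u hu
        rcases Nat.lt_succ_iff_lt_or_eq.1 hi with hi | rfl
        · exact (h3 i hi p hp v hv).extend_right hvu
        · simp only [allocation, hn, Option.bind_some, hq, Option.mem_def,
            Option.some.injEq] at hp
          rwa [← hp]

/-- The Kraft-Chaitin lemma: requests of total size at most `1` can be satisfied online. -/
theorem allocation_spec {l : ℕ → Option ℕ} (hl : ∑' n, requestMass (l n) ≤ 1) :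
    (∀ n, (allocation l n).map List.length = l n) ∧
      ∀ i j, i ≠ j → ∀ p ∈ allocation l i, ∀ q ∈ allocation l j, Incomparable p q := by
  have key (n k : ℕ) (hn : l n = some k) :
      ∃ w ∈ freeList l n, ∃ p, allocation l n = some p ∧ w <+: p ∧ p.length = k := by
    obtain ⟨h1, h2, h3⟩ := freeList_spec hl n
    have hk : mass k ≤ freeMass (freeList l n) := by
      have h4 : ∑ i ∈ Finset.range (n + 1), requestMass (l i) ≤ 1 :=
        (ENNReal.sum_le_tsum _).trans hl
      rw [Finset.sum_range_succ, hn, ← h2] at h4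
      refine (ENNReal.add_le_add_iff_left ?_).1 h4
      exact ne_top_of_le_ne_top ENNReal.one_ne_top (h2 ▸ le_self_add)
    obtain ⟨w, hw, q, hq, hwq, hqk, -⟩ := alloc_spec h1 hk
    exact ⟨w, hw, q, by simp [allocation, hn, hq], hwq, hqk⟩
  have hlt (i j : ℕ) (hij : i < j) (p q : Str) (hp : p ∈ allocation l i)
      (hq : q ∈ allocation l j) : Incomparable p q := by
    cases hj : l j with
    | none => simp [allocation, hj] at hq
    | some k =>
      obtain ⟨w, hw, q', hq', hwq, -⟩ := key j k hj
      obtain rfl : q' = q := by rw [Option.mem_def, hq'] at hq; exact Option.some.inj hq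
      exact ((freeList_spec hl j).2.2 i hij p hp w hw).extend_right hwq
  refine ⟨fun n => ?_, fun i j hij p hp q hq => ?_⟩
  · cases hn : l n with
    | none => simp [allocation, hn]
    | some k =>
      obtain ⟨w, hw, q, hq, -, hk⟩ := key n k hn
      simp [hq, hk]
  · rcases lt_or_gt_of_ne hij with h | h
    · exact hlt i j h p q hp hq
    · exact (hlt j i h q p hq hp).symm

/-! ### Computability of basic operations -/

theorem primrec_prefix : PrimrecRel fun q p : Str => q <+: p :=
  (Primrec.eq.comp₂ (Primrec.list_take.comp₂ (Primrec.list_length.comp₂ Primrec₂.left)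
    Primrec₂.right) Primrec₂.left).of_eq fun q p => by
      rw [List.prefix_iff_eq_take, eq_comm]

theorem primrec_replicate : Primrec fun n => List.replicate n false :=
  (Primrec.list_map Primrec.list_range (Primrec₂.const false)).of_eq fun n => by simp

theorem primrec_unary : Primrec unary :=
  Primrec.list_append.comp primrec_replicate (Primrec.const [true])

theorem primrec_pow_two : Primrec fun n : ℕ => 2 ^ n :=
  (Primrec.nat_rec₁ 1 (Primrec.nat_mul.comp₂ (Primrec₂.const 2) Primrec₂.right)).of_eq fun n => by
    induction n with
    | zero => rfl
    | succ n ih => simp only [ih, pow_succ']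

/-- Whether `p` holds for all numbers below `n`. -/
def allBelow (p : ℕ → Bool) (n : ℕ) : Bool := Nat.rec true (fun i b => b && p i) n

theorem allBelow_eq_true {p : ℕ → Bool} {n : ℕ} : allBelow p n = true ↔ ∀ i < n, p i = true := by
  induction n with
  | zero => simp [allBelow]
  | succ n ih =>
    change (allBelow p n && p n) = true ↔ _
    rw [Bool.and_eq_true, ih]
    constructor
    · rintro ⟨h1, h2⟩ i hi
      rcases Nat.lt_succ_iff_lt_or_eq.1 hi with hi | rfl
      exacts [h1 i hi, h2]
    · exact fun h => ⟨fun i hi => h i (by omega), h n (by omega)⟩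

section

variable {α β : Type} [Primcodable α] [Primcodable β]

theorem computable_allBelow {p : α → ℕ → Bool} {f : α → ℕ} (hp : Computable₂ p)
    (hf : Computable f) : Computable fun a => allBelow (p a) (f a) :=
  Computable.nat_rec hf (Computable.const true)
    ((Primrec.and.to_comp.comp (Computable.snd.comp Computable.snd)
      (hp.comp Computable.fst (Computable.fst.comp Computable.snd))).to₂ :
        Computable₂ fun (a : α) (y : ℕ × Bool) => y.2 && p a y.1)

theorem computable_sum_range {g : α → ℕ → ℕ} {f : α → ℕ} (hg : Computable₂ g)
    (hf : Computable f) : Computable fun a => ∑ i ∈ Finset.range (f a), g a i :=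
  (Computable.nat_rec hf (Computable.const 0)
    ((Primrec.nat_add.to_comp.comp (Computable.snd.comp Computable.snd)
      (hg.comp Computable.fst (Computable.fst.comp Computable.snd))).to₂ :
        Computable₂ fun (a : α) (y : ℕ × ℕ) => y.2 + g a y.1)).of_eq fun a => by
    induction f a with
    | zero => rfl
    | succ n ih => simp only [ih, Finset.sum_range_succ]

theorem computable_ite {c : α → Prop} [DecidablePred c] {f g : α → β}
    (hc : Computable fun a => decide (c a)) (hf : Computable f) (hg : Computable g) :
    Computable fun a => if c a then f a else g a :=
  (Computable.cond hc hf hg).of_eq fun a => by by_cases h : c a <;> simp [h]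

theorem computable_find {p : α → ℕ → Bool} (hp : Computable₂ p)
    (h : ∀ a, ∃ n, p a n = true) : Computable fun a => Nat.find (h a) := by
  refine Partrec.of_eq_tot (Partrec.rfind (p := fun a n => Part.some (p a n)) hp) fun a => ?_
  refine Nat.mem_rfind.2 ⟨?_, fun {m} hm => ?_⟩
  · simpa using (Nat.find_spec (h a)).symm
  · simpa using Nat.find_min (h a) hm

end

theorem primrec_alloc : Primrec₂ alloc := by
  have hle : PrimrecRel fun (w : Str) (k : ℕ) => w.length ≤ k :=
    Primrec.nat_le.comp₂ (Primrec.list_length.comp₂ Primrec₂.left) Primrec₂.right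
  refine Primrec.option_map (f := fun a : ℕ × List Str =>
    (a.2.filter fun w => w.length ≤ a.1).head?) (g := fun a w =>
      w ++ List.replicate (a.1 - w.length) false) (Primrec.list_head?.comp
    (hle.listFilter.comp Primrec.snd Primrec.fst)) ?_
  exact Primrec.list_append.comp Primrec.snd (primrec_replicate.comp
    (Primrec.nat_sub.comp (Primrec.fst.comp Primrec.fst) (Primrec.list_length.comp Primrec.snd)))

theorem primrec_siblings : Primrec₂ siblings := by
  refine Primrec.list_map (f := fun a : ℕ × Str => List.range (a.1 - a.2.length))
    (g := fun a i => a.2 ++ unary (a.1 - a.2.length - 1 - i))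
    (Primrec.list_range.comp (Primrec.nat_sub.comp Primrec.fst
      (Primrec.list_length.comp Primrec.snd))) ?_
  refine Primrec.list_append.comp (Primrec.snd.comp Primrec.fst) (primrec_unary.comp
    (Primrec.nat_sub.comp (Primrec.nat_sub.comp (Primrec.nat_sub.comp
      (Primrec.fst.comp Primrec.fst)
      (Primrec.list_length.comp (Primrec.snd.comp Primrec.fst))) (Primrec.const 1)) Primrec.snd))

theorem primrec_remaining : Primrec₂ remaining := by
  have hle : PrimrecRel fun (w : Str) (k : ℕ) => w.length ≤ k :=
    Primrec.nat_le.comp₂ (Primrec.list_length.comp₂ Primrec₂.left) Primrec₂.right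
  have hlt : PrimrecRel fun (w : Str) (k : ℕ) => k < w.length :=
    Primrec.nat_lt.comp₂ Primrec₂.right (Primrec.list_length.comp₂ Primrec₂.left)
  have hA : Primrec fun a : ℕ × List Str => a.2.filter fun w => w.length ≤ a.1 :=
    hle.listFilter.comp Primrec.snd Primrec.fst
  refine (Primrec.list_append.comp (hlt.listFilter.comp Primrec.snd Primrec.fst)
    (Primrec.list_append.comp (Primrec.option_getD.comp (Primrec.option_map
      (Primrec.list_head?.comp hA) ?_) (Primrec.const [])) (Primrec.list_tail.comp hA)) :
        Primrec fun a : ℕ × List Str => _)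
  exact primrec_siblings.comp (Primrec.fst.comp Primrec.fst) Primrec.snd

theorem computable_allocation {l : ℕ → Option ℕ} (hl : Computable l) :
    Computable (allocation l) := by
  have hfree : Computable (freeList l) := by
    refine Computable.nat_rec (h := fun (_ : ℕ) (y : ℕ × List Str) =>
      ((l y.1).map fun k => remaining k y.2).getD y.2) Computable.id (Computable.const [[]]) ?_
    refine Computable.option_getD (Computable.option_map (hl.comp
      (Computable.fst.comp Computable.snd)) ?_) (Computable.snd.comp Computable.snd)
    exact primrec_remaining.to_comp.comp Computable.snd
      (Computable.snd.comp (Computable.snd.comp Computable.fst))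
  exact Computable.option_bind hl (primrec_alloc.to_comp.comp Computable.snd
    (hfree.comp Computable.fst)).to₂

/-! ### Prefix-free and prefix-stable machines defined by enumerations -/

/-- The class of prefix-free machines for `b = true`, of prefix-stable machines for
`b = false`. -/
def MachineClass (b : Bool) : Machine → Prop := bif b then PrefixFree else PrefixStable

/-- `p` is a description of everything that `q` has to describe. -/
def Matches (b : Bool) (q p : Str) : Prop := q <+: p ∧ (b = true → q = p)

instance (b : Bool) (q p : Str) : Decidable (Matches b q p) :=
  inferInstanceAs (Decidable (_ ∧ _))

theorem Matches.refl (b : Bool) (p : Str) : Matches b p p := ⟨List.prefix_rfl, fun _ => rfl⟩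

theorem primrec_matches (b : Bool) : PrimrecRel (Matches b) := by
  cases b
  · exact primrec_prefix.of_eq fun q p => by simp [Matches]
  · refine PrimrecRel.of_eq (r := fun q p : Str => q = p) Primrec.eq fun q p => ?_
    simp only [Matches, forall_const]
    exact ⟨fun h => ⟨h ▸ List.prefix_rfl, h⟩, And.right⟩

/-- Two pairs (description, object) that may occur in one machine. -/
def Compat (b : Bool) (y z : Str × Str) : Prop :=
  y.1 <+: z.1 → Matches b y.1 z.1 ∧ y.2 = z.2

instance (b : Bool) (y z : Str × Str) : Decidable (Compat b y z) :=
  inferInstanceAs (Decidable (_ → _))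

/-- A set of pairs (description, object) that may be part of the graph of one machine. -/
def Consistent (b : Bool) (G : Set (Str × Str)) : Prop := ∀ y ∈ G, ∀ z ∈ G, Compat b y z

/-- The set enumerated by `e`. -/
def rangeOf {β : Type} (e : ℕ → Option β) : Set β := {y | ∃ i, e i = some y}

/-- The graph of a machine. -/
def graph (U : Machine) : Set (Str × Str) := {y | y.2 ∈ U y.1}

/-- The common form of both definitions. Closure under `Matches` is vacuous for prefix-free
machines, and for prefix-stable machines it already implies consistency. -/
theorem machineClass_iff {b : Bool} {U : Machine} :
    MachineClass b U ↔ Partrec U ∧ Consistent b (graph U) ∧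
      ∀ p q x, x ∈ U p → Matches b p q → x ∈ U q := by
  cases b
  · change PrefixStable U ↔ _
    simp only [PrefixStable, Consistent, Compat, Matches, graph]
    constructor
    · rintro ⟨h1, h2⟩
      refine ⟨h1, fun y hy z hz hyz => ⟨⟨hyz, by simp⟩, ?_⟩,
        fun p q x hx hpq => h2 p q x hx hpq.1⟩
      exact Part.mem_unique (h2 _ _ _ hy hyz) hz
    · rintro ⟨h1, -, h2⟩
      exact ⟨h1, fun p q x hx hpq => h2 p q x hx ⟨hpq, by simp⟩⟩
  · change PrefixFree U ↔ _
    simp only [PrefixFree, Consistent, Compat, Matches, graph]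
    constructor
    · rintro ⟨h1, h2⟩
      refine ⟨h1, fun y hy z hz hyz => ?_, fun p q x hx hpq => hpq.2 trivial ▸ hx⟩
      have := h2 _ _ (Part.dom_iff_mem.2 ⟨_, hy⟩) (Part.dom_iff_mem.2 ⟨_, hz⟩) hyz
      refine ⟨⟨hyz, fun _ => this⟩, ?_⟩
      change y.2 ∈ U y.1 at hy
      rw [this] at hy
      exact Part.mem_unique hy hz
    · rintro ⟨h1, h2, -⟩
      refine ⟨h1, fun p q hp hq hpq => ?_⟩
      obtain ⟨x, hx⟩ := Part.dom_iff_mem.1 hp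
      obtain ⟨x', hx'⟩ := Part.dom_iff_mem.1 hq
      exact (h2 (p, x) hx (q, x') hx' hpq).1.2 trivial

/-- The machine given by an enumeration of pairs (description, object). -/
def enumMachine (b : Bool) (e : ℕ → Option (Str × Str)) : Machine := fun p =>
  Nat.rfindOpt fun i => (e i).bind fun y => if Matches b y.1 p then some y.2 else none

/-- The search returns the first hit, but the choice is immaterial: all enumerated `q` matching `p`
are prefixes of `p`, hence comparable, and consistency gives them the same object. -/
theorem mem_enumMachine {b : Bool} {e : ℕ → Option (Str × Str)}
    (he : Consistent b (rangeOf e)) {p x : Str} :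
    x ∈ enumMachine b e p ↔ ∃ q, Matches b q p ∧ (q, x) ∈ rangeOf e := by
  have hspec {z : Str} (hz : z ∈ enumMachine b e p) :
      ∃ q, Matches b q p ∧ (q, z) ∈ rangeOf e := by
    obtain ⟨i, hi⟩ := Nat.rfindOpt_spec hz
    simp only [Option.mem_def, Option.bind_eq_some_iff] at hi
    obtain ⟨⟨q, y⟩, h1, h2⟩ := hi
    split_ifs at h2 with h3
    obtain rfl := Option.some.inj h2
    exact ⟨q, h3, i, h1⟩
  refine ⟨hspec, ?_⟩
  rintro ⟨q, hq, i, hi⟩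
  have hdom : (enumMachine b e p).Dom :=
    Nat.rfindOpt_dom.2 ⟨i, x, by simp [hi, hq]⟩
  obtain ⟨q', hq', hx'⟩ := hspec (Part.get_mem hdom)
  suffices x = (enumMachine b e p).get hdom by rw [this]; exact Part.get_mem hdom
  rcases List.prefix_or_prefix_of_prefix hq.1 hq'.1 with h | h
  · exact (he (q, x) ⟨i, hi⟩ _ hx' h).2
  · exact (he _ hx' (q, x) ⟨i, hi⟩ h).2.symm

theorem partrec_enumMachine (b : Bool) {e : ℕ → Option (Str × Str)} (he : Computable e) :
    Partrec (enumMachine b e) := by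
  refine Partrec.rfindOpt ?_
  refine Computable.option_bind (he.comp Computable.snd) ?_
  refine computable_ite (α := (Str × ℕ) × Str × Str) (c := fun a => Matches b a.2.1 a.1.1) ?_
    (Computable.option_some.comp (Computable.snd.comp Computable.snd)) (Computable.const none)
  exact (primrec_matches b).decide.to_comp.comp (Computable.fst.comp Computable.snd)
    (Computable.fst.comp Computable.fst)

theorem machineClass_enumMachine {b : Bool} {e : ℕ → Option (Str × Str)} (hc : Computable e)
    (he : Consistent b (rangeOf e)) : MachineClass b (enumMachine b e) := by
  refine machineClass_iff.2 ⟨partrec_enumMachine b hc, ?_, ?_⟩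
  · rintro ⟨p, x⟩ hp ⟨p', x'⟩ hp' hpp'
    obtain ⟨q, hq, hx⟩ := (mem_enumMachine he).1 hp
    obtain ⟨q', hq', hx'⟩ := (mem_enumMachine he).1 hp'
    simp only at hpp'
    have hxx : x = x' ∧ (b = true → q = q') := by
      rcases List.prefix_or_prefix_of_prefix (hq.1.trans hpp') hq'.1 with h | h
      · have := he _ hx _ hx' h
        exact ⟨this.2, this.1.2⟩
      · have := he _ hx' _ hx h
        exact ⟨this.2.symm, fun hb => (this.1.2 hb).symm⟩
    exact ⟨⟨hpp', fun hb => (hq.2 hb).symm.trans ((hxx.2 hb).trans (hq'.2 hb))⟩, hxx.1⟩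
  · intro p q x hx hpq
    obtain ⟨w, hw, hwx⟩ := (mem_enumMachine he).1 hx
    refine (mem_enumMachine he).2 ⟨w, ⟨hw.1.trans hpq.1, fun hb => ?_⟩, hwx⟩
    rw [hw.2 hb, hpq.2 hb]

/-! ### A universal enumeration -/

/-- The value of the partial computable function with number `n` on the string `q`, if it is
found within `s` steps. -/
def evalStr (n s : ℕ) (q : Str) : Option Str :=
  (Nat.Partrec.Code.evaln s (Denumerable.ofNat Nat.Partrec.Code n) (Encodable.encode q)).bind
    (Encodable.decode (α := Str))

theorem computable_evalStr : Computable fun a : ℕ × ℕ × Str => evalStr a.1 a.2.1 a.2.2 := by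
  have h := Nat.Partrec.Code.primrec_evaln.to_comp
  have h1 : Computable fun a : ℕ × ℕ × Str =>
      ((a.2.1, Denumerable.ofNat Nat.Partrec.Code a.1), Encodable.encode a.2.2) :=
    Computable.pair (Computable.pair (Computable.fst.comp Computable.snd)
      ((Computable.ofNat _).comp Computable.fst))
      (Computable.encode.comp (Computable.snd.comp Computable.snd))
  exact Computable.option_bind (h.comp h1)
    (Computable.decode.comp Computable.snd : Computable fun a : (ℕ × ℕ × Str) × ℕ => _)

/-- An enumeration of the graph of the partial computable function with number `n`. -/
def graphEnum (n i : ℕ) : Option (Str × Str) :=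
  (Encodable.decode (α := Str) i.unpair.2).bind fun q =>
    (evalStr n i.unpair.1 q).map fun x => (q, x)

theorem computable_graphEnum : Computable₂ graphEnum := by
  have h1 : Computable fun a : (ℕ × ℕ) × Str => (a.1.1, a.1.2.unpair.1, a.2) :=
    Computable.pair (Computable.fst.comp Computable.fst) (Computable.pair
      (Computable.fst.comp (Computable.unpair.comp (Computable.snd.comp Computable.fst)))
      Computable.snd)
  have h2 : Computable fun a : ℕ × ℕ => Encodable.decode (α := Str) a.2.unpair.2 :=
    Computable.decode.comp (Computable.snd.comp (Computable.unpair.comp Computable.snd))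
  have h3 : Computable fun a : (ℕ × ℕ) × Str => evalStr a.1.1 a.1.2.unpair.1 a.2 := by
    have h := computable_evalStr
    generalize evalStr = f at h ⊢
    exact h.comp h1
  have h4 : Computable₂ fun (a : (ℕ × ℕ) × Str) (x : Str) => (a.2, x) :=
    Computable.pair (Computable.snd.comp Computable.fst) Computable.snd
  have h5 : Computable₂ fun (a : ℕ × ℕ) (q : Str) =>
      (evalStr a.1 a.2.unpair.1 q).map fun x => (q, x) := Computable.option_map h3 h4
  exact Computable.option_bind h2 h5

theorem exists_rangeOf_graphEnum {U : Machine} (hU : Partrec U) :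
    ∃ n, rangeOf (graphEnum n) = graph U := by
  obtain ⟨c, hc⟩ := Nat.Partrec.Code.exists_code.1 hU
  refine ⟨Encodable.encode c, ?_⟩
  have hm {q : Str} {m : ℕ} :
      m ∈ Nat.Partrec.Code.eval c (Encodable.encode q) ↔ ∃ x ∈ U q, Encodable.encode x = m := by
    rw [hc]; simp
  ext ⟨q, x⟩
  simp only [rangeOf, graph, graphEnum, evalStr, Set.mem_ofPred_eq, Denumerable.ofNat_encode]
  constructor
  · rintro ⟨i, hi⟩
    simp only [Option.bind_eq_some_iff, Option.map_eq_some_iff, Prod.mk.injEq] at hi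
    obtain ⟨q, -, x, ⟨m, h1, h2⟩, rfl, rfl⟩ := hi
    obtain ⟨x', hx', rfl⟩ := hm.1 (Nat.Partrec.Code.evaln_sound h1)
    rw [Encodable.encodek] at h2
    rwa [← Option.some.inj h2]
  · intro hx
    obtain ⟨s, hs⟩ := Nat.Partrec.Code.evaln_complete.1 (hm.2 ⟨x, hx, rfl⟩)
    refine ⟨Nat.pair s (Encodable.encode q), ?_⟩
    rw [Option.mem_def] at hs
    simp [hs]

/-- The subsequence of those pairs that are compatible with all earlier ones. -/
def trim (b : Bool) (e : ℕ → Option (Str × Str)) (i : ℕ) : Option (Str × Str) :=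
  (e i).bind fun y =>
    if allBelow (fun j => ((e j).map fun z =>
      decide (Compat b y z) && decide (Compat b z y)).getD true) i = true then some y else none

theorem primrec_compat (b : Bool) : PrimrecRel (Compat b) := by
  have h1 : PrimrecRel fun y z : Str × Str => y.1 <+: z.1 :=
    primrec_prefix.comp₂ (Primrec.fst.comp₂ Primrec₂.left) (Primrec.fst.comp₂ Primrec₂.right)
  have h2 : PrimrecRel fun y z : Str × Str => Matches b y.1 z.1 :=
    (primrec_matches b).comp₂ (Primrec.fst.comp₂ Primrec₂.left) (Primrec.fst.comp₂ Primrec₂.right)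
  have h3 : PrimrecRel fun y z : Str × Str => y.2 = z.2 :=
    Primrec.eq.comp₂ (Primrec.snd.comp₂ Primrec₂.left) (Primrec.snd.comp₂ Primrec₂.right)
  exact PrimrecRel.of_eq (PrimrecPred.or (PrimrecPred.not h1)
    (PrimrecPred.and h2 h3)).primrecRel fun y z => imp_iff_not_or.symm

theorem computable_trim (b : Bool) {e : ℕ → ℕ → Option (Str × Str)} (he : Computable₂ e) :
    Computable₂ fun n => trim b (e n) := by
  refine Computable.option_bind he ?_
  refine computable_ite (α := (ℕ × ℕ) × Str × Str) (c := fun a =>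
    allBelow (fun j => ((e a.1.1 j).map fun z =>
      decide (Compat b a.2 z) && decide (Compat b z a.2)).getD true) a.1.2 = true) ?_
    (Computable.option_some.comp Computable.snd) (Computable.const none)
  simp only [Bool.decide_eq_true]
  refine computable_allBelow ?_ (Computable.snd.comp Computable.fst)
  refine Computable.option_getD (Computable.option_map (he.comp
    (Computable.fst.comp (Computable.fst.comp Computable.fst)) Computable.snd) ?_)
    (Computable.const true)
  have hc : Computable₂ fun y z => decide (Compat b y z) := (primrec_compat b).decide.to_comp
  have h1 : Computable fun a : (((ℕ × ℕ) × Str × Str) × ℕ) × Str × Str => a.1.1.2 :=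
    Computable.snd.comp (Computable.fst.comp Computable.fst)
  exact Primrec.and.to_comp.comp (hc.comp h1 Computable.snd) (hc.comp Computable.snd h1)

theorem trim_eq_some {b : Bool} {e : ℕ → Option (Str × Str)} {i : ℕ} {y : Str × Str} :
    trim b e i = some y ↔
      e i = some y ∧ ∀ j < i, ∀ z, e j = some z → Compat b y z ∧ Compat b z y := by
  simp only [trim, Option.bind_eq_some_iff, Option.ite_none_right_eq_some, allBelow_eq_true,
    Option.some.injEq]
  constructor
  · rintro ⟨y, h1, h2, rfl⟩
    refine ⟨h1, fun j hj z hz => ?_⟩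
    have := h2 j hj
    simpa [hz] using this
  · rintro ⟨h1, h2⟩
    refine ⟨y, h1, fun j hj => ?_, rfl⟩
    cases hz : e j with
    | none => rfl
    | some z => simpa using h2 j hj z hz

/-- Each kept pair has been compared with all earlier pairs of `e`, kept or not, so no record of the
kept ones is needed. An enumeration that is already consistent loses nothing (`rangeOf_trim`), so
trimming all partial computable functions lists exactly the graphs needed. -/
theorem consistent_trim (b : Bool) (e : ℕ → Option (Str × Str)) :
    Consistent b (rangeOf (trim b e)) := by
  rintro y ⟨i, hi⟩ z ⟨j, hj⟩
  obtain ⟨hi, hi'⟩ := trim_eq_some.1 hi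
  obtain ⟨hj, hj'⟩ := trim_eq_some.1 hj
  rcases lt_trichotomy i j with h | rfl | h
  · exact (hj' i h y hi).2
  · obtain rfl := Option.some.inj (hi.symm.trans hj)
    exact fun _ => ⟨Matches.refl b _, rfl⟩
  · exact (hi' j h z hj).1

theorem rangeOf_trim {b : Bool} {e : ℕ → Option (Str × Str)} (he : Consistent b (rangeOf e)) :
    rangeOf (trim b e) = rangeOf e := by
  ext y
  constructor
  · rintro ⟨i, hi⟩
    exact ⟨i, (trim_eq_some.1 hi).1⟩
  · rintro ⟨i, hi⟩
    exact ⟨i, trim_eq_some.2 ⟨hi, fun j _ z hz =>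
      ⟨he _ ⟨i, hi⟩ _ ⟨j, hz⟩, he _ ⟨j, hz⟩ _ ⟨i, hi⟩⟩⟩⟩

/-- An enumeration of a universal machine: the `n`-th machine is called by the prefix
`unary n`. -/
def universalEnum (b : Bool) (i : ℕ) : Option (Str × Str) :=
  (trim b (graphEnum i.unpair.1) i.unpair.2).map fun y => (unary i.unpair.1 ++ y.1, y.2)

theorem computable_universalEnum (b : Bool) : Computable (universalEnum b) := by
  refine Computable.option_map ((computable_trim b computable_graphEnum).comp
    (Computable.fst.comp Computable.unpair) (Computable.snd.comp Computable.unpair)) ?_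
  exact Computable.pair (Computable.list_append.comp (primrec_unary.to_comp.comp
    (Computable.fst.comp (Computable.unpair.comp Computable.fst)))
    (Computable.fst.comp Computable.snd)) (Computable.snd.comp Computable.snd)

theorem mem_rangeOf_universalEnum {b : Bool} {p x : Str} :
    (p, x) ∈ rangeOf (universalEnum b) ↔
      ∃ n q, p = unary n ++ q ∧ (q, x) ∈ rangeOf (trim b (graphEnum n)) := by
  constructor
  · rintro ⟨i, hi⟩
    simp only [universalEnum, Option.map_eq_some_iff, Prod.mk.injEq] at hi
    obtain ⟨⟨q, y⟩, h1, rfl, rfl⟩ := hi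
    exact ⟨_, q, rfl, _, h1⟩
  · rintro ⟨n, q, rfl, i, hi⟩
    exact ⟨Nat.pair n i, by simp [universalEnum, hi]⟩

theorem Matches.append_left {b : Bool} {p q : Str} (w : Str) (h : Matches b p q) :
    Matches b (w ++ p) (w ++ q) :=
  ⟨(List.prefix_append_right_inj w).2 h.1, fun hb => by rw [h.2 hb]⟩

theorem matches_append_left_iff {b : Bool} {p q w : Str} :
    Matches b (w ++ p) (w ++ q) ↔ Matches b p q :=
  ⟨fun h => ⟨(List.prefix_append_right_inj w).1 h.1, fun hb => List.append_cancel_left (h.2 hb)⟩,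
    Matches.append_left w⟩

theorem consistent_universalEnum (b : Bool) : Consistent b (rangeOf (universalEnum b)) := by
  rintro ⟨p, x⟩ hy ⟨p', x'⟩ hz h
  obtain ⟨n, q, rfl, hq⟩ := mem_rangeOf_universalEnum.1 hy
  obtain ⟨n', q', rfl, hq'⟩ := mem_rangeOf_universalEnum.1 hz
  obtain ⟨rfl, h'⟩ := unary_append_prefix h
  have := consistent_trim b _ _ hq _ hq' h'
  exact ⟨this.1.append_left _, this.2⟩

/-- Phrased for the enumeration instead of its machine because `exists_universal` moves the
enumeration into the cone of another string. -/
theorem exists_universalEnum {b : Bool} {V : Machine} (hV : MachineClass b V) :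
    ∃ n, ∀ x z, z ∈ V x ↔
      ∃ q, Matches b q (unary n ++ x) ∧ (q, z) ∈ rangeOf (universalEnum b) := by
  obtain ⟨h1, h2, h3⟩ := machineClass_iff.1 hV
  obtain ⟨n, hn⟩ := exists_rangeOf_graphEnum h1
  have ht : rangeOf (trim b (graphEnum n)) = graph V := by
    rw [rangeOf_trim (by rwa [hn]), hn]
  refine ⟨n, fun x z => ⟨fun hz => ?_, ?_⟩⟩
  · exact ⟨_, Matches.refl b _, mem_rangeOf_universalEnum.2 ⟨n, x, rfl, by rw [ht]; exact hz⟩⟩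
  · rintro ⟨q, hq, hz⟩
    obtain ⟨m, q, rfl, hz'⟩ := mem_rangeOf_universalEnum.1 hz
    obtain ⟨rfl, -⟩ := unary_append_prefix hq.1
    rw [ht] at hz'
    exact h3 q x z hz' (matches_append_left_iff.1 hq)

/-! ### Extended natural numbers -/

theorem enat_le_of_forall {a c : ℕ∞} (h : ∀ m : ℕ, c ≤ m → a ≤ m) : a ≤ c := by
  cases c with
  | top => exact le_top
  | coe n => exact h n le_rfl

theorem enat_ext {a c : ℕ∞} (h : ∀ m : ℕ, a ≤ m ↔ c ≤ m) : a = c :=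
  le_antisymm (enat_le_of_forall fun m => (h m).2) (enat_le_of_forall fun m => (h m).1)

/-- The finite value of an extended natural number, if it is finite. -/
def finiteValue (a : ℕ∞) : Option ℕ := a

/-- The extended natural number coded by an optional one. -/
def ofOption (o : Option ℕ) : ℕ∞ := o

@[simp] theorem finiteValue_top : finiteValue ⊤ = none := rfl

@[simp] theorem finiteValue_coe (m : ℕ) : finiteValue (m : ℕ∞) = some m := rfl

@[simp] theorem ofOption_none : ofOption none = ⊤ := rfl

@[simp] theorem ofOption_some (m : ℕ) : ofOption (some m) = (m : ℕ∞) := rfl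

theorem finiteValue_eq_some {a : ℕ∞} {m : ℕ} : finiteValue a = some m ↔ a = m := by
  cases a with
  | top => simp
  | coe n => simp

theorem primrec_finiteValue : Primrec finiteValue :=
  (Primrec.id : Primrec (id : Option ℕ → Option ℕ))

theorem primrec_ofOption : Primrec ofOption :=
  (Primrec.id : Primrec (id : Option ℕ → Option ℕ))

theorem primrec_min_enat : Primrec₂ fun a c : ℕ∞ => min a c := by
  have h : Primrec fun y : ℕ∞ × ℕ∞ => ofOption (Option.casesOn (finiteValue y.1)
      (finiteValue y.2) fun m => some ((((finiteValue y.2).map (min m)).getD m))) := by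
    refine primrec_ofOption.comp (Primrec.option_casesOn (primrec_finiteValue.comp Primrec.fst)
      (primrec_finiteValue.comp Primrec.snd) ?_)
    refine Primrec.option_some.comp (Primrec.option_getD.comp (Primrec.option_map
      (primrec_finiteValue.comp (Primrec.snd.comp Primrec.fst)) ?_) Primrec.snd)
    exact Primrec.nat_min.comp (Primrec.snd.comp Primrec.fst) Primrec.snd
  refine h.of_eq ?_
  rintro ⟨a, c⟩
  cases a with
  | top => cases c <;> simp
  | coe m =>
    cases c with
    | top => simp
    | coe n => 
      have h : Monotone ((↑) : ℕ → ℕ∞) := fun i j hij => by exact_mod_cast hij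
      simpa using h.map_min (a := m) (b := n)

@[simp] theorem weight_top : weight ⊤ = 0 := by simp [weight]

@[simp] theorem weight_coe (m : ℕ) : weight m = mass m := by simp [weight, mass]

theorem weight_antitone : Antitone weight := by
  intro a c h
  cases c with
  | top => simp
  | coe n =>
    lift a to ℕ using ne_top_of_le_ne_top (ENat.natCast_ne_top n) h
    rw [weight_coe, weight_coe]
    exact mass_antitone (by exact_mod_cast h)

/-! ### Complexity functions are upper semicomputable -/

theorem KS_le_iff {U : Machine} {x : Str} {m : ℕ} :
    KS U x ≤ m ↔ ∃ p, x ∈ U p ∧ p.length ≤ m := by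
  -- A strict bound on an infimum yields a witness, so `≤ m` is read as `< m + 1`.
  rw [← ENat.lt_natCast_add_one_iff, KS]
  simp only [iInf_lt_iff, exists_prop]
  norm_cast
  simp only [Nat.lt_succ_iff]

theorem KS_enumMachine_le_iff {b : Bool} {e : ℕ → Option (Str × Str)}
    (he : Consistent b (rangeOf e)) {x : Str} {m : ℕ} :
    KS (enumMachine b e) x ≤ m ↔ ∃ q, (q, x) ∈ rangeOf e ∧ q.length ≤ m := by
  rw [KS_le_iff]
  constructor
  · rintro ⟨p, hp, hm⟩
    obtain ⟨q, hq, hx⟩ := (mem_enumMachine he).1 hp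
    exact ⟨q, hx, hq.1.length_le.trans hm⟩
  · rintro ⟨q, hq, hm⟩
    exact ⟨q, (mem_enumMachine he).2 ⟨q, Matches.refl b q, hq⟩, hm⟩

/-- `K` is the least function that satisfies all the requests `K x ≤ k` enumerated by `r`. -/
def Enumerates (r : ℕ → Option (Str × ℕ)) (K : Str → ℕ∞) : Prop :=
  ∀ (x : Str) (m : ℕ), K x ≤ m ↔ ∃ k ≤ m, (x, k) ∈ rangeOf r

theorem exists_enumerates_KS {U : Machine} (hU : Partrec U) :
    ∃ r, Computable r ∧ Enumerates r (KS U) := by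
  obtain ⟨n, hn⟩ := exists_rangeOf_graphEnum hU
  refine ⟨fun i => (graphEnum n i).map fun y => (y.2, y.1.length), ?_, fun x m => ?_⟩
  · refine Computable.option_map (computable_graphEnum.comp (Computable.const n) Computable.id) ?_
    exact Computable.pair (Computable.snd.comp Computable.snd)
      (Computable.list_length.comp (Computable.fst.comp Computable.snd))
  · rw [KS_le_iff]
    constructor
    · rintro ⟨p, hp, hm⟩
      have : (p, x) ∈ rangeOf (graphEnum n) := by rw [hn]; exact hp
      obtain ⟨i, hi⟩ := this
      exact ⟨_, hm, i, by simp [hi]⟩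
    · rintro ⟨k, hk, i, hi⟩
      simp only [Option.map_eq_some_iff, Prod.mk.injEq] at hi
      obtain ⟨⟨p, y⟩, h1, rfl, rfl⟩ := hi
      have : (p, y) ∈ graph U := by rw [← hn]; exact ⟨i, h1⟩
      exact ⟨p, this, hk⟩

/-- The bound on the value at `x` given by one request. -/
def requestValue (o : Option (Str × ℕ)) (x : Str) : ℕ∞ :=
  ofOption (o.bind fun y => if y.1 = x then some y.2 else none)

theorem requestValue_le_iff {o : Option (Str × ℕ)} {x : Str} {m : ℕ} :
    requestValue o x ≤ m ↔ ∃ k ≤ m, o = some (x, k) := by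
  cases o with
  | none => simp [requestValue]
  | some y =>
    obtain ⟨y, k⟩ := y
    by_cases h : y = x <;> simp [requestValue, h]

/-- The bound on the value at `x` given by the first `n` requests. -/
noncomputable def approximation (r : ℕ → Option (Str × ℕ)) (n : ℕ) (x : Str) : ℕ∞ :=
  Nat.rec ⊤ (fun i c => min c (requestValue (r i) x)) n

theorem approximation_succ (r : ℕ → Option (Str × ℕ)) (n : ℕ) (x : Str) :
    approximation r (n + 1) x = min (approximation r n x) (requestValue (r n) x) := rfl

theorem approximation_le_iff {r : ℕ → Option (Str × ℕ)} {n : ℕ} {x : Str} {m : ℕ} :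
    approximation r n x ≤ m ↔ ∃ k ≤ m, ∃ i < n, r i = some (x, k) := by
  induction n with
  | zero => simp [approximation]
  | succ n ih =>
    rw [approximation_succ, min_le_iff, ih, requestValue_le_iff]
    constructor
    · rintro (⟨k, hk, i, hi, h⟩ | ⟨k, hk, h⟩)
      exacts [⟨k, hk, i, by omega, h⟩, ⟨k, hk, n, by omega, h⟩]
    · rintro ⟨k, hk, i, hi, h⟩
      rcases Nat.lt_succ_iff_lt_or_eq.1 hi with hi | rfl
      exacts [Or.inl ⟨k, hk, i, hi, h⟩, Or.inr ⟨k, hk, h⟩]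

theorem computable_approximation {r : ℕ → Option (Str × ℕ)} (hr : Computable r) :
    Computable₂ (approximation r) := by
  have h1 : Computable fun a : (ℕ × Str) × ℕ × ℕ∞ => requestValue (r a.2.1) a.1.2 := by
    refine primrec_ofOption.to_comp.comp (Computable.option_bind
      (hr.comp (Computable.fst.comp Computable.snd)) ?_)
    exact computable_ite (α := ((ℕ × Str) × ℕ × ℕ∞) × Str × ℕ) (c := fun a => a.2.1 = a.1.1.2)
      (Primrec.eq.decide.to_comp.comp (Computable.fst.comp Computable.snd)
        (Computable.snd.comp (Computable.fst.comp Computable.fst)))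
      (Computable.option_some.comp (Computable.snd.comp Computable.snd)) (Computable.const none)
  exact Computable.nat_rec (f := fun a : ℕ × Str => a.1) (g := fun _ => ⊤)
    (h := fun a y => min y.2 (requestValue (r y.1) a.2)) Computable.fst (Computable.const ⊤)
    (primrec_min_enat.to_comp.comp (Computable.snd.comp Computable.snd) h1)

/-- `k` is a computable non-increasing sequence of functions that stabilizes to `K`. -/
structure Approximates (k : ℕ → Str → ℕ∞) (K : Str → ℕ∞) : Prop where
  computable : Computable₂ k
  le : ∀ n x, K x ≤ k n x
  antitone : ∀ x, Antitone fun n => k n x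
  eventually : ∀ x, ∀ᶠ n in atTop, k n x = K x

/-- Finite points of `ℕ∞` are isolated, and where the limit is `⊤` the non-increasing sequence is
constantly `⊤`; so convergence means eventual equality. -/
theorem upperSemicomputable_iff {K : Str → ℕ∞} :
    UpperSemicomputable K ↔ ∃ k, Approximates k K := by
  constructor
  · rintro ⟨k, h1, h2, h3⟩
    have hle : ∀ n x, K x ≤ k n x := fun n x => (h2 x).le_of_tendsto (h3 x) n
    refine ⟨k, h1, hle, h2, fun x => ?_⟩
    rcases eq_or_ne (K x) ⊤ with h | h
    · exact Eventually.of_forall fun n => by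
        rw [h]; exact top_le_iff.1 (h ▸ hle n x)
    · have : {y | y = K x} ∈ 𝓝 (K x) := by
        simpa using (ENat.isOpen_singleton h).mem_nhds rfl
      exact h3 x this
  · rintro ⟨k, hk⟩
    exact ⟨k, hk.computable, hk.antitone, fun x =>
      tendsto_const_nhds.congr' ((hk.eventually x).mono fun n hn => hn.symm)⟩

theorem Enumerates.approximates {r : ℕ → Option (Str × ℕ)} {K : Str → ℕ∞} (h : Enumerates r K)
    (hr : Computable r) : Approximates (approximation r) K := by
  have hle : ∀ n x, K x ≤ approximation r n x := fun n x => enat_le_of_forall fun m hm => by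
    obtain ⟨k, hk, i, -, hi⟩ := approximation_le_iff.1 hm
    exact (h x m).2 ⟨k, hk, i, hi⟩
  refine ⟨computable_approximation hr, hle,
    fun x => antitone_nat_of_succ_le fun n => min_le_left _ _, fun x => ?_⟩
  cases hx : K x with
  | top => exact Eventually.of_forall fun n => top_le_iff.1 (hx ▸ hle n x)
  | coe m =>
    obtain ⟨k, hk, i, hi⟩ := (h x m).1 hx.le
    filter_upwards [eventually_gt_atTop i] with n hn
    exact le_antisymm (approximation_le_iff.2 ⟨k, hk, i, hn, hi⟩) (hx ▸ hle n x)

/-- One shortest description is chosen for each object. Comparable descriptions describe the same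
object, so the chosen ones form a prefix-free code even if `U` is only prefix-stable. -/
theorem tsum_weight_KS_le_one {b : Bool} {U : Machine} (hU : MachineClass b U) :
    ∑' x, weight (KS U x) ≤ 1 := by
  obtain ⟨-, h, -⟩ := machineClass_iff.1 hU
  have hs : Function.support (fun x => weight (KS U x)) ⊆ {x | KS U x ≠ ⊤} := by
    intro x hx hx'
    simp [hx'] at hx
  rw [← tsum_subtype_eq_of_support_subset hs]
  have hp (x : {x | KS U x ≠ ⊤}) : ∃ p, x.1 ∈ U p ∧ KS U x = (p.length : ℕ∞) := by
    obtain ⟨m, hm⟩ := ENat.ne_top_iff_exists.1 x.2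
    obtain ⟨p, hp, hpm⟩ := KS_le_iff.1 hm.ge
    exact ⟨p, hp, le_antisymm (KS_le_iff.2 ⟨p, hp, le_rfl⟩)
      (by rw [← hm]; exact_mod_cast hpm)⟩
  choose p hp hl using hp
  refine le_of_eq_of_le (tsum_congr fun x => ?_) (tsum_mass_length_le_one p fun x y hxy => ?_)
  · rw [hl x, weight_coe]
  · exact Subtype.ext (h (p x, x.1) (hp x) (p y, y.1) (hp y) hxy).2

theorem KS_mem_semimeasureClass {b : Bool} {U : Machine} (hU : MachineClass b U) :
    KS U ∈ semimeasureClass := by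
  obtain ⟨r, hr, h⟩ := exists_enumerates_KS (machineClass_iff.1 hU).1
  exact ⟨upperSemicomputable_iff.2 ⟨_, h.approximates hr⟩, tsum_weight_KS_le_one hU⟩

/-! ### Lower bounds for the sum of weights -/

/-- The contribution of the value `a` at stage `s`. -/
def stageTerm (s : ℕ) (a : ℕ∞) : ℕ :=
  ((finiteValue a).map fun m => if m ≤ s then 2 ^ (s - m) else 0).getD 0

/-- The sum of weights known at stage `s`, multiplied by `2 ^ s`. -/
def stageSum (k : ℕ → Str → ℕ∞) (s : ℕ) : ℕ :=
  ∑ i ∈ Finset.range s,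
    ((Encodable.decode₂ Str i).map fun x => stageTerm s (k s x)).getD 0

/-- At stage `s`, it is known that the sum of weights is more than `1 - 2 ^ (-m)`. -/
def NearlyOne (k : ℕ → Str → ℕ∞) (s m : ℕ) : Prop :=
  m ≤ s ∧ 2 ^ s < stageSum k s + 2 ^ (s - m)

instance (k : ℕ → Str → ℕ∞) (s m : ℕ) : Decidable (NearlyOne k s m) :=
  inferInstanceAs (Decidable (_ ∧ _))

theorem computable_stageTerm : Computable₂ stageTerm := by
  refine Computable.option_getD (Computable.option_map
    (primrec_finiteValue.to_comp.comp Computable.snd) ?_) (Computable.const 0)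
  exact computable_ite (α := (ℕ × ℕ∞) × ℕ) (c := fun a => a.2 ≤ a.1.1)
    (Primrec.nat_le.decide.to_comp.comp Computable.snd (Computable.fst.comp Computable.fst))
    (primrec_pow_two.to_comp.comp (Primrec.nat_sub.to_comp.comp
      (Computable.fst.comp Computable.fst) Computable.snd)) (Computable.const 0)

theorem computable_decode₂ : Computable fun i => Encodable.decode₂ Str i := by
  have h : Computable fun i : ℕ => (Encodable.decode (α := Str) i).bind fun x =>
      if Encodable.encode x = i then some x else none := by
    refine Computable.option_bind Computable.decode ?_
    exact computable_ite (α := ℕ × Str) (c := fun a => Encodable.encode a.2 = a.1)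
      (Primrec.eq.decide.to_comp.comp (Computable.encode.comp Computable.snd) Computable.fst)
      (Computable.option_some.comp Computable.snd) (Computable.const none)
  refine h.of_eq fun i => ?_
  simp [Encodable.decode₂, Option.guard]

theorem computable_stageSum {k : ℕ → Str → ℕ∞} (hk : Computable₂ k) :
    Computable (stageSum k) := by
  have h2 : Computable₂ fun (a : ℕ × ℕ) (x : Str) => stageTerm a.1 (k a.1 x) :=
    computable_stageTerm.comp (Computable.fst.comp Computable.fst)
      (hk.comp (Computable.fst.comp Computable.fst) Computable.snd)
  have h3 : Computable₂ fun (s i : ℕ) =>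
      ((Encodable.decode₂ Str i).map fun x => stageTerm s (k s x)).getD 0 :=
    Computable.option_getD (Computable.option_map (computable_decode₂.comp Computable.snd) h2)
      (Computable.const 0)
  exact computable_sum_range h3 Computable.id

theorem computable_nearlyOne {k : ℕ → Str → ℕ∞} (hk : Computable₂ k) :
    Computable₂ fun s m => decide (NearlyOne k s m) := by
  have h : Computable fun a : ℕ × ℕ => decide (a.2 ≤ a.1) &&
      decide (2 ^ a.1 < stageSum k a.1 + 2 ^ (a.1 - a.2)) := by
    refine Primrec.and.to_comp.comp
      (Primrec.nat_le.decide.to_comp.comp Computable.snd Computable.fst)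
      (Primrec.nat_lt.decide.to_comp.comp (primrec_pow_two.to_comp.comp Computable.fst)
        (Primrec.nat_add.to_comp.comp ((computable_stageSum hk).comp Computable.fst)
          (primrec_pow_two.to_comp.comp (Primrec.nat_sub.to_comp.comp Computable.fst
            Computable.snd))))
  exact h.of_eq fun a => by rw [← Bool.decide_and]; rfl

/-- The strings considered at stage `s`. -/
noncomputable def stageSet (s : ℕ) : Finset Str :=
  (Finset.range s).preimage Encodable.encode Encodable.encode_injective.injOn

@[simp] theorem mem_stageSet {s : ℕ} {x : Str} : x ∈ stageSet s ↔ Encodable.encode x < s := by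
  simp [stageSet]

theorem stageTerm_mul_mass (s : ℕ) (a : ℕ∞) :
    (stageTerm s a : ℝ≥0∞) * mass s = if a ≤ s then weight a else 0 := by
  cases a with
  | top => simp [stageTerm]
  | coe m =>
    by_cases h : m ≤ s
    · simp only [stageTerm, finiteValue_coe, Option.map_some, h, if_true, Option.getD_some,
        Nat.cast_le, weight_coe]
      conv_lhs => rw [← Nat.add_sub_cancel' h, mass_add]
      rw [Nat.add_sub_cancel' h, mul_comm (mass m), ← mul_assoc]
      push_cast
      rw [mass, ← mul_pow, ENNReal.mul_inv_cancel (by simp) (by simp), one_pow, one_mul]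
    · simp [stageTerm, h]

theorem stageSum_mul_mass (k : ℕ → Str → ℕ∞) (s : ℕ) :
    (stageSum k s : ℝ≥0∞) * mass s =
      ∑ x ∈ stageSet s, if k s x ≤ s then weight (k s x) else 0 := by
  simp only [← stageTerm_mul_mass]
  rw [stageSum, Nat.cast_sum, Finset.sum_mul, stageSet,
    ← Finset.sum_preimage (Encodable.encode (α := Str)) (Finset.range s)
      Encodable.encode_injective.injOn]
  · simp
  · intro i _ hi
    have : Encodable.decode₂ Str i = none := by
      rw [← Option.not_isSome_iff_eq_none, Option.isSome_iff_exists]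
      rintro ⟨x, hx⟩
      exact hi ⟨x, Encodable.mem_decode₂.1 hx⟩
    simp [this]

/-- The integer inequality, decidable by computation, is divided by `2 ^ s`. -/
theorem nearlyOne_iff {k : ℕ → Str → ℕ∞} {s m : ℕ} : NearlyOne k s m ↔ m ≤ s ∧
    1 < (∑ x ∈ stageSet s, if k s x ≤ s then weight (k s x) else 0) + mass m := by
  refine and_congr_right fun h => ?_
  have h1 := stageTerm_mul_mass s m
  have h2 := stageTerm_mul_mass s 0
  simp only [stageTerm, finiteValue_coe, Option.map_some, h, if_true, Option.getD_some,
    Nat.cast_le, weight_coe] at h1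
  have h2 : ((2 ^ s : ℕ) : ℝ≥0∞) * mass s = 1 := by
    push_cast
    rw [mass, ← mul_pow, ENNReal.mul_inv_cancel (by simp) (by simp), one_pow]
  rw [← stageSum_mul_mass, ← h1, ← h2, ← add_mul,
    ENNReal.mul_lt_mul_iff_left (mass_ne_zero s) (mass_ne_top s)]
  norm_cast

section

variable {k : ℕ → Str → ℕ∞} {K : Str → ℕ∞} {s m : ℕ} {x : Str}

/-- A string not yet considered whose value is at most `m` would add `2 ^ (-m)` to a sum that
already exceeds `1 - 2 ^ (-m)`. -/
theorem NearlyOne.lt (h : NearlyOne k s m) (hk : Approximates k K)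
    (hK : ∑' x, weight (K x) ≤ 1) (hx : s ≤ Encodable.encode x) : m < K x := by
  by_contra! hm
  refine absurd ((nearlyOne_iff.1 h).2.trans_le (le_trans ?_ hK)) (lt_irrefl _)
  have hxs : x ∉ stageSet s := by simpa using hx
  calc _ ≤ (∑ y ∈ stageSet s, weight (K y)) + weight (K x) := by
        refine add_le_add (Finset.sum_le_sum fun y _ => ?_) ?_
        · split_ifs
          exacts [weight_antitone (hk.le s y), zero_le]
        · exact weight_coe m ▸ weight_antitone hm
    _ = ∑ y ∈ Finset.cons x (stageSet s) hxs, weight (K y) := by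
        rw [Finset.sum_cons, add_comm]
    _ ≤ _ := ENNReal.sum_le_tsum _

theorem NearlyOne.eq (h : NearlyOne k s m) (hk : Approximates k K)
    (hK : ∑' x, weight (K x) ≤ 1) (hx : Encodable.encode x < s) (hm : k s x = m) :
    K x = m := by
  refine (hm ▸ hk.le s x).eq_of_not_lt fun hlt => ?_
  refine absurd ((nearlyOne_iff.1 h).2.trans_le (le_trans ?_ hK)) (lt_irrefl _)
  obtain ⟨j, hj⟩ := ENat.ne_top_iff_exists.1 hlt.ne_top
  -- A decrease from `m` at least doubles the weight of `x`, so it adds at least `2 ^ (-m)`, which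
  -- no longer fits.
  have hw : mass m + mass m ≤ weight (K x) := by
    rw [← hj, weight_coe, ← mass_succ_add_self j]
    have : j + 1 ≤ m := by rw [← hj] at hlt; exact_mod_cast hlt
    exact add_le_add (mass_antitone this) (mass_antitone this)
  have hxs : x ∈ stageSet s := by simpa using hx
  refine le_trans ?_ (ENNReal.sum_le_tsum (stageSet s))
  rw [← Finset.add_sum_erase _ _ hxs, ← Finset.add_sum_erase _ _ hxs, add_right_comm]
  refine add_le_add (le_trans (add_le_add ?_ le_rfl) hw) (Finset.sum_le_sum fun y _ => ?_)
  · rw [hm, weight_coe]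
    split_ifs
    exacts [le_rfl, zero_le]
  · split_ifs
    exacts [weight_antitone (hk.le s y), zero_le]

theorem Approximates.eventually_nearlyOne (hk : Approximates k K)
    (hK : ∑' x, weight (K x) = 1) (m : ℕ) : ∀ᶠ s in atTop, NearlyOne k s m := by
  have h1 : 1 - mass m < ∑' x, weight (K x) := by
    rw [hK]; exact ENNReal.sub_lt_self ENNReal.one_ne_top one_ne_zero (mass_ne_zero m)
  rw [ENNReal.tsum_eq_iSup_sum, lt_iSup_iff] at h1
  obtain ⟨F, hF⟩ := h1
  -- From some stage on, every string of `F` is considered, has its final value, and is counted by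
  -- the stage sum; those of value `⊤` are not counted but weigh nothing.
  have h2 : ∀ᶠ s in atTop, ∀ y ∈ F, k s y = K y ∧ Encodable.encode y < s ∧
      (K y ≤ s ∨ K y = ⊤) := by
    refine (Filter.eventually_all_finset F).2 fun y _ => ?_
    refine (hk.eventually y).and ((eventually_gt_atTop _).and ?_)
    cases K y with
    | top => simp
    | coe n =>
      filter_upwards [eventually_ge_atTop n] with s hs
      exact Or.inl (by exact_mod_cast hs)
  filter_upwards [h2, eventually_ge_atTop m] with s hs hm
  refine nearlyOne_iff.2 ⟨hm, ?_⟩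
  have h3 : 1 < (∑ y ∈ F, weight (K y)) + mass m := by
    contrapose! hF
    exact ENNReal.le_sub_of_add_le_right (mass_ne_top m) hF
  refine h3.trans_le (add_le_add ?_ le_rfl)
  calc ∑ y ∈ F, weight (K y) = ∑ y ∈ F, if k s y ≤ s then weight (k s y) else 0 := by
        refine Finset.sum_congr rfl fun y hy => ?_
        obtain ⟨h4, -, h5 | h5⟩ := hs y hy
        · rw [h4, if_pos h5]
        · rw [h4, h5]; simp
    _ ≤ _ := Finset.sum_le_sum_of_subset fun y hy => mem_stageSet.2 (hs y hy).2.1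

end

/-! ### Requests for a semicomputable function -/

/-- All the values of the functions `f s` as requests. -/
def valueRequests (f : ℕ → Str → ℕ∞) (i : ℕ) : Option (Str × ℕ) :=
  (Encodable.decode (α := Str) i.unpair.1).bind fun x =>
    (finiteValue (f i.unpair.2 x)).map fun m => (x, m)

theorem computable_valueRequests {f : ℕ → Str → ℕ∞} (hf : Computable₂ f) :
    Computable (valueRequests f) := by
  have h1 : Computable fun i : ℕ => Encodable.decode (α := Str) i.unpair.1 :=
    Computable.decode.comp (Computable.fst.comp Computable.unpair)
  have h2 : Computable fun a : ℕ × Str => finiteValue (f a.1.unpair.2 a.2) :=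
    primrec_finiteValue.to_comp.comp (hf.comp
      (Computable.snd.comp (Computable.unpair.comp Computable.fst)) Computable.snd)
  have h3 : Computable₂ fun (a : ℕ × Str) (m : ℕ) => (a.2, m) :=
    Computable.pair (Computable.snd.comp Computable.fst) Computable.snd
  have h4 : Computable₂ fun (i : ℕ) (x : Str) =>
      (finiteValue (f i.unpair.2 x)).map fun m => (x, m) := Computable.option_map h2 h3
  exact Computable.option_bind h1 h4

theorem mem_rangeOf_valueRequests {f : ℕ → Str → ℕ∞} {x : Str} {m : ℕ} :
    (x, m) ∈ rangeOf (valueRequests f) ↔ ∃ s, f s x = m := by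
  constructor
  · rintro ⟨i, hi⟩
    simp only [valueRequests, Option.bind_eq_some_iff, Option.map_eq_some_iff,
      Prod.mk.injEq] at hi
    obtain ⟨y, -, n, h, rfl, rfl⟩ := hi
    exact ⟨_, finiteValue_eq_some.1 h⟩
  · rintro ⟨s, hs⟩
    exact ⟨Nat.pair (Encodable.encode x) s, by simp [valueRequests, hs]⟩

/-- The subsequence of those requests that have not been made before. -/
def withoutRepetitions (r : ℕ → Option (Str × ℕ)) (i : ℕ) : Option (Str × ℕ) :=
  if allBelow (fun j => decide (r j ≠ r i)) i = true then r i else none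

theorem computable_withoutRepetitions {r : ℕ → Option (Str × ℕ)} (hr : Computable r) :
    Computable (withoutRepetitions r) := by
  refine computable_ite (c := fun i => allBelow (fun j => decide (r j ≠ r i)) i = true) ?_ hr
    (Computable.const none)
  simp only [Bool.decide_eq_true]
  refine computable_allBelow (p := fun i j => decide (r j ≠ r i)) ?_ Computable.id
  have h : Computable fun a : ℕ × ℕ => !decide (r a.2 = r a.1) :=
    Primrec.not.to_comp.comp (Primrec.eq.decide.to_comp.comp (hr.comp Computable.snd)
      (hr.comp Computable.fst))
  exact h.of_eq fun a => by simp

theorem withoutRepetitions_eq_some {r : ℕ → Option (Str × ℕ)} {i : ℕ} {y : Str × ℕ} :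
    withoutRepetitions r i = some y ↔ r i = some y ∧ ∀ j < i, r j ≠ some y := by
  simp only [withoutRepetitions, Option.ite_none_right_eq_some, allBelow_eq_true,
    decide_eq_true_eq]
  constructor
  · rintro ⟨h1, h2⟩
    exact ⟨h2, fun j hj => h2 ▸ h1 j hj⟩
  · rintro ⟨h1, h2⟩
    exact ⟨fun j hj => h1 ▸ h2 j hj, h1⟩

theorem rangeOf_withoutRepetitions (r : ℕ → Option (Str × ℕ)) :
    rangeOf (withoutRepetitions r) = rangeOf r := by
  ext y
  constructor
  · rintro ⟨i, hi⟩
    exact ⟨i, (withoutRepetitions_eq_some.1 hi).1⟩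
  · intro h
    classical
    exact ⟨Nat.find h, withoutRepetitions_eq_some.2 ⟨Nat.find_spec h,
      fun j hj => Nat.find_min h hj⟩⟩

/-- The total size of the requests enumerated by `r`, with multiplicities. -/
noncomputable def requestSum (r : ℕ → Option (Str × ℕ)) : ℝ≥0∞ :=
  ∑' i, requestMass ((r i).map Prod.snd)

open Classical in
/-- The total size of all the finite values of the functions `f s` at `x`. -/
noncomputable def valueMass (f : ℕ → Str → ℕ∞) (x : Str) : ℝ≥0∞ :=
  ∑' m : ℕ, if ∃ s, f s x = m then mass m else 0

/-- Without repetitions, the requests inject into the pairs (string, value attained there). -/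
theorem requestSum_withoutRepetitions_le (f : ℕ → Str → ℕ∞) :
    requestSum (withoutRepetitions (valueRequests f)) ≤ ∑' x, valueMass f x := by
  classical
  set r := withoutRepetitions (valueRequests f) with hr
  have hs : Function.support (fun i => requestMass ((r i).map Prod.snd)) ⊆
      {i | (r i).isSome} := by
    intro i hi
    cases h : r i with
    | none => simp [h, requestMass] at hi
    | some y => simp [h]
  have hinj : Function.Injective fun i : {i | (r i).isSome} => (r i.1).get i.2 := by
    intro i j hij
    obtain ⟨y, hy⟩ := Option.isSome_iff_exists.1 i.2
    obtain ⟨z, hz⟩ := Option.isSome_iff_exists.1 j.2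
    simp only [hy, hz, Option.get_some] at hij
    subst hij
    obtain ⟨h1, h2⟩ := withoutRepetitions_eq_some.1 hy
    obtain ⟨h3, h4⟩ := withoutRepetitions_eq_some.1 hz
    refine Subtype.ext (le_antisymm (not_lt.1 fun h => h2 _ h h3) (not_lt.1 fun h => h4 _ h h1))
  have hle := ENNReal.tsum_comp_le_tsum_of_injective hinj
    fun y : Str × ℕ => if ∃ s, f s y.1 = y.2 then mass y.2 else 0
  rw [requestSum, ← tsum_subtype_eq_of_support_subset hs]
  refine le_trans (le_of_eq (tsum_congr fun i => ?_)) (hle.trans (le_of_eq ENNReal.tsum_prod'))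
  obtain ⟨y, hy⟩ := Option.isSome_iff_exists.1 i.2
  have hy' : (y.1, y.2) ∈ rangeOf (valueRequests f) := ⟨_, (withoutRepetitions_eq_some.1 hy).1⟩
  simp [hy, requestMass, mem_rangeOf_valueRequests.1 hy']

theorem enumerates_withoutRepetitions {f : ℕ → Str → ℕ∞} {K : Str → ℕ∞}
    (h1 : ∀ s x, K x ≤ f s x) (h2 : ∀ x, ∃ s, f s x = K x) :
    Enumerates (withoutRepetitions (valueRequests f)) K := by
  intro x m
  rw [rangeOf_withoutRepetitions]
  simp only [mem_rangeOf_valueRequests]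
  constructor
  · intro h
    obtain ⟨s, hs⟩ := h2 x
    obtain ⟨n, hn⟩ := ENat.ne_top_iff_exists.1 (ne_top_of_le_ne_top (ENat.natCast_ne_top m) h)
    exact ⟨n, by rw [← hn] at h; exact_mod_cast h, s, by rw [hs, hn]⟩
  · rintro ⟨k, hk, s, hs⟩
    calc K x ≤ f s x := h1 s x
      _ = k := hs
      _ ≤ m := by exact_mod_cast hk

theorem valueMass_eq {f : ℕ → Str → ℕ∞} {x : Str} {a : ℕ∞} (h : ∀ s, f s x = a ∨ f s x = ⊤) :
    valueMass f x ≤ weight a := by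
  classical
  rw [valueMass]
  cases a with
  | top =>
    refine le_of_eq (ENNReal.tsum_eq_zero.2 fun m => if_neg ?_)
    rintro ⟨s, hs⟩
    rcases h s with h | h <;> simp [h] at hs
  | coe n =>
    rw [tsum_eq_single n]
    · rw [weight_coe]; split_ifs; exacts [le_rfl, zero_le]
    · intro m hm
      refine if_neg ?_
      rintro ⟨s, hs⟩
      rcases h s with h | h
      · rw [h] at hs; exact hm (by exact_mod_cast hs.symm)
      · simp [h] at hs

/-- Obsolete values cost at most a factor of two: distinct values from `n` on weigh at most `∑ 2 ^
(-m)` over `m ≥ n`, which is `2 * 2 ^ (-n)`. -/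
theorem valueMass_le {f : ℕ → Str → ℕ∞} {x : Str} {a : ℕ∞} (h : ∀ s, a ≤ f s x) :
    valueMass f x ≤ 2 * weight a := by
  classical
  rw [valueMass]
  cases a with
  | top =>
    refine le_of_eq_of_le (ENNReal.tsum_eq_zero.2 fun m => if_neg ?_) zero_le
    rintro ⟨s, hs⟩
    have := h s
    simp [hs] at this
  | coe n =>
    have h0 : ∑ m ∈ Finset.range n, (if ∃ s, f s x = m then mass m else 0) = 0 := by
      refine Finset.sum_eq_zero fun m hm => if_neg ?_
      rintro ⟨s, hs⟩
      have := h s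
      rw [hs] at this
      exact absurd (Finset.mem_range.1 hm) (not_lt.2 (by exact_mod_cast this))
    rw [← Summable.sum_add_tsum_nat_add' (k := n) ENNReal.summable, h0, zero_add, weight_coe]
    calc _ ≤ ∑' i, mass (i + n) := ENNReal.tsum_le_tsum fun i => by
            split_ifs; exacts [le_rfl, zero_le]
      _ = ∑' i, (mass (i + 1) + mass (i + 1)) * mass n := tsum_congr fun i => by
            rw [mass_succ_add_self, mass_add]
      _ = 2 * mass n := by
            rw [ENNReal.tsum_mul_right, ENNReal.tsum_add, tsum_mass_succ, one_add_one_eq_two]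

/-- Choose a finite `F` outside which even the doubled weights sum to less than the gap `1 - ∑
weight (K x)`, and a time `t` after which the values on `F` are final. Strings in `F` then cost only
their true weight. -/
theorem Approximates.exists_tsum_valueMass_lt {k : ℕ → Str → ℕ∞} {K : Str → ℕ∞}
    (hk : Approximates k K) (hK : ∑' x, weight (K x) < 1) :
    ∃ t, ∑' x, valueMass (fun s => k (s + t)) x < 1 := by
  have hfin : ∑' x, 2 * weight (K x) ≠ ∞ := by
    rw [ENNReal.tsum_mul_left]
    exact ENNReal.mul_ne_top (by simp) hK.ne_top
  have hlim := ENNReal.tendsto_tsum_compl_atTop_zero hfin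
  have hpos : 0 < 1 - ∑' x, weight (K x) := tsub_pos_of_lt hK
  obtain ⟨F, hF⟩ := (hlim.eventually (gt_mem_nhds hpos)).exists
  obtain ⟨t, ht⟩ := eventually_atTop.1
    ((Filter.eventually_all_finset F).2 fun x _ => hk.eventually x)
  refine ⟨t, ?_⟩
  rw [← ENNReal.sum_add_tsum_compl F]
  have h1 : ∑ x ∈ F, valueMass (fun s => k (s + t)) x ≤ ∑' x, weight (K x) :=
    (Finset.sum_le_sum fun x hx => valueMass_eq fun s =>
      Or.inl (ht (s + t) (Nat.le_add_left _ _) x hx)).trans (ENNReal.sum_le_tsum F)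
  have h2 : ∑' x : {x // x ∉ F}, valueMass (fun s => k (s + t)) x <
      1 - ∑' x, weight (K x) :=
    (ENNReal.tsum_le_tsum fun x : {x // x ∉ F} =>
      valueMass_le fun s => hk.le (s + t) x.1).trans_lt hF
  calc _ < ∑' x, weight (K x) + (1 - ∑' x, weight (K x)) :=
        ENNReal.add_lt_add_of_le_of_lt (ne_top_of_le_ne_top hK.ne_top h1) h1 h2
    _ = 1 := add_tsub_cancel_of_le hK.le

/-- Every function of the class is given by requests of total size at most `1`, and of total size
less than `1` if its sum of weights is. -/
theorem exists_requests {K : Str → ℕ∞} (hK : K ∈ semimeasureClass) :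
    ∃ r, Computable r ∧ Enumerates r K ∧ requestSum r ≤ 1 ∧
      (∑' x, weight (K x) < 1 → requestSum r < 1) := by
  obtain ⟨hK, h1⟩ := hK
  obtain ⟨k, hk⟩ := upperSemicomputable_iff.1 hK
  rcases h1.lt_or_eq with hlt | heq
  · obtain ⟨t, ht⟩ := hk.exists_tsum_valueMass_lt hlt
    have h2 := (requestSum_withoutRepetitions_le fun s => k (s + t)).trans_lt ht
    refine ⟨withoutRepetitions (valueRequests fun s => k (s + t)),
      computable_withoutRepetitions (computable_valueRequests ?_),
      enumerates_withoutRepetitions (fun s x => hk.le (s + t) x) fun x => ?_, h2.le, fun _ => h2⟩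
    · exact hk.computable.comp (Primrec.nat_add.to_comp.comp Computable.fst (Computable.const t))
        Computable.snd
    · obtain ⟨n, hn⟩ := eventually_atTop.1 (hk.eventually x)
      exact ⟨n, hn _ (Nat.le_add_right _ _)⟩
  -- The sum is `1`, so there is no room for an obsolete request. A value is published only when the
  -- visible sum certifies it as final; since the sum tends to `1`, every finite value is eventually
  -- certified.
  · set f : ℕ → Str → ℕ∞ := fun s x => ofOption ((finiteValue (k s x)).bind fun m =>
      if NearlyOne k s m ∧ Encodable.encode x < s then some m else none) with hf
    have hfs (s : ℕ) (x : Str) : f s x = K x ∨ f s x = ⊤ := by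
      simp only [hf]
      cases hm : k s x with
      | top => simp
      | coe m =>
        by_cases h : NearlyOne k s m ∧ Encodable.encode x < s
        · simp [h, h.1.eq hk h1 h.2 hm]
        · simp [h]
    have hfc : Computable₂ f := by
      have h2 : Computable₂ fun (a : ℕ × Str) (m : ℕ) =>
          if NearlyOne k a.1 m ∧ Encodable.encode a.2 < a.1 then some m else none := by
        refine computable_ite (α := (ℕ × Str) × ℕ)
          (c := fun a => NearlyOne k a.1.1 a.2 ∧ Encodable.encode a.1.2 < a.1.1) ?_
          (Computable.option_some.comp Computable.snd) (Computable.const none)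
        have h3 : Computable fun a : (ℕ × Str) × ℕ => decide (NearlyOne k a.1.1 a.2) &&
            decide (Encodable.encode a.1.2 < a.1.1) :=
          Primrec.and.to_comp.comp ((computable_nearlyOne hk.computable).comp
            (Computable.fst.comp Computable.fst) Computable.snd)
            (Primrec.nat_lt.decide.to_comp.comp (Computable.encode.comp
              (Computable.snd.comp Computable.fst)) (Computable.fst.comp Computable.fst))
        exact h3.of_eq fun a => by rw [← Bool.decide_and]
      exact primrec_ofOption.to_comp.comp (Computable.option_bind
        (primrec_finiteValue.to_comp.comp hk.computable) h2)
    refine ⟨withoutRepetitions (valueRequests f),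
      computable_withoutRepetitions (computable_valueRequests hfc),
      enumerates_withoutRepetitions (fun s x => ?_) fun x => ?_, ?_, fun h => absurd heq h.ne⟩
    · rcases hfs s x with h | h <;> simp [h]
    · cases hx : K x with
      | top => exact ⟨0, by rcases hfs 0 x with h | h <;> simp [h, hx]⟩
      | coe m =>
        obtain ⟨s, h2, h3, h4⟩ := ((hk.eventually x).and
          ((eventually_gt_atTop (Encodable.encode x)).and
          (hk.eventually_nearlyOne heq m))).exists
        exact ⟨s, by simp [hf, h2, hx, h3, h4]⟩
    · refine (requestSum_withoutRepetitions_le f).trans ((ENNReal.tsum_le_tsum fun x => ?_).trans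
        h1)
      exact valueMass_eq fun s => hfs s x

/-! ### Machines with prescribed complexity functions -/

/-- The pairs (description, object) given by the allocation `a` to the requests `r`. -/
def describe (a : ℕ → Option Str) (r : ℕ → Option (Str × ℕ)) (i : ℕ) : Option (Str × Str) :=
  (a i).bind fun q => (r i).map fun y => (q, y.1)

theorem computable_describe {a : ℕ → Option Str} {r : ℕ → Option (Str × ℕ)} (ha : Computable a)
    (hr : Computable r) : Computable (describe a r) := by
  have h1 : Computable₂ fun (i : ℕ) (q : Str) => (r i).map fun y => (q, y.1) :=
    Computable.option_map (hr.comp Computable.fst)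
      (Computable.pair (Computable.snd.comp Computable.fst) (Computable.fst.comp Computable.snd) :
        Computable fun a : (ℕ × Str) × Str × ℕ => _)
  exact Computable.option_bind ha h1

theorem describe_eq_some {a : ℕ → Option Str} {r : ℕ → Option (Str × ℕ)} {i : ℕ} {q x : Str} :
    describe a r i = some (q, x) ↔ a i = some q ∧ ∃ k, r i = some (x, k) := by
  simp [describe, Option.bind_eq_some_iff]

/-- The optional extra request `o` is served first, in slot `0`. Its string `w` is left out of the
enumeration, which reserves its whole cone for other use. -/
theorem exists_enumeration {r : ℕ → Option (Str × ℕ)} (hr : Computable r) {o : Option ℕ}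
    (ho : requestSum r + requestMass o ≤ 1) :
    ∃ (w : Option Str) (e : ℕ → Option (Str × Str)), w.map List.length = o ∧ Computable e ∧
      (∀ v ∈ w, ∀ y ∈ rangeOf e, Incomparable v y.1) ∧ (∀ b, Consistent b (rangeOf e)) ∧
      ∀ x k, (x, k) ∈ rangeOf r ↔ ∃ q, q.length = k ∧ (q, x) ∈ rangeOf e := by
  set l : ℕ → Option ℕ := fun n => Nat.casesOn n o fun i => (r i).map Prod.snd with hl
  have hlc : Computable l := by
    refine Computable.nat_casesOn Computable.id (Computable.const o) ?_
    exact Computable.option_map (hr.comp Computable.snd)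
      (Computable.snd.comp Computable.snd : Computable fun a : (ℕ × ℕ) × Str × ℕ => _)
  have hsum : ∑' n, requestMass (l n) ≤ 1 := by
    rw [tsum_eq_zero_add' ENNReal.summable, add_comm]
    exact ho
  obtain ⟨h1, h2⟩ := allocation_spec hsum
  have ha : Computable fun i => allocation l (i + 1) :=
    (computable_allocation hlc).comp Computable.succ
  refine ⟨allocation l 0, describe (fun i => allocation l (i + 1)) r, h1 0, computable_describe ha hr, ?_,
    fun b => ?_, fun x k => ?_⟩
  · rintro v hv ⟨q, x⟩ ⟨i, hi⟩
    exact h2 0 (i + 1) (by simp) v hv q (describe_eq_some.1 hi).1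
  · rintro ⟨q, x⟩ ⟨i, hi⟩ ⟨q', x'⟩ ⟨j, hj⟩ h
    by_cases hij : i = j
    · subst hij
      obtain ⟨rfl, rfl⟩ := Prod.mk.inj (Option.some.inj (hi.symm.trans hj))
      exact ⟨Matches.refl b _, rfl⟩
    · exact absurd h (h2 (i + 1) (j + 1) (by simpa using hij) q (describe_eq_some.1 hi).1 q'
        (describe_eq_some.1 hj).1).1
  · constructor
    · rintro ⟨i, hi⟩
      have h3 : (allocation l (i + 1)).map List.length = (r i).map Prod.snd := h1 (i + 1)
      rw [hi] at h3
      obtain ⟨q, hq, hk⟩ := Option.map_eq_some_iff.1 h3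
      exact ⟨q, hk, i, describe_eq_some.2 ⟨hq, k, hi⟩⟩
    · rintro ⟨q, rfl, i, hi⟩
      obtain ⟨hq, k, hk⟩ := describe_eq_some.1 hi
      have hq : allocation l (i + 1) = some q := hq
      have h3 : (allocation l (i + 1)).map List.length = (r i).map Prod.snd := h1 (i + 1)
      rw [hq, hk] at h3
      exact ⟨i, by rw [Option.some.inj h3, hk]⟩

theorem exists_machine {r : ℕ → Option (Str × ℕ)} (hr : Computable r) (h : requestSum r ≤ 1)
    (b : Bool) : ∃ U, MachineClass b U ∧
      ∀ (x : Str) (m : ℕ), KS U x ≤ m ↔ ∃ k ≤ m, (x, k) ∈ rangeOf r := by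
  obtain ⟨-, e, -, he, -, h1, h2⟩ := exists_enumeration hr (o := none)
    (by simpa [requestMass] using h)
  refine ⟨enumMachine b e, machineClass_enumMachine he (h1 b), fun x m => ?_⟩
  rw [KS_enumMachine_le_iff (h1 b)]
  constructor
  · rintro ⟨q, hq, hm⟩
    exact ⟨_, hm, (h2 _ _).2 ⟨q, rfl, hq⟩⟩
  · rintro ⟨k, hk, hx⟩
    obtain ⟨q, rfl, hq⟩ := (h2 _ _).1 hx
    exact ⟨q, hq, hk⟩

theorem complexities_machineClass (b : Bool) :
    complexities (MachineClass b) = semimeasureClass := by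
  ext K
  constructor
  · rintro ⟨U, hU, rfl⟩
    exact KS_mem_semimeasureClass hU
  · intro hK
    obtain ⟨r, hr, h1, h2, -⟩ := exists_requests hK
    obtain ⟨U, hU, h⟩ := exists_machine hr h2 b
    exact ⟨U, hU, funext fun x => enat_ext fun m => (h x m).trans (h1 x m).symm⟩

/-- The requests have sizes `2 ^ (-(n + 1))` and total `1`. Such machines are the competitors that
minimal functions and optimal machines are tested against. -/
theorem exists_machine_KS_le {f : ℕ → Str} (hf : Computable f) (b : Bool) :
    ∃ U, MachineClass b U ∧ ∀ n : ℕ, KS U (f n) ≤ (n + 1 : ℕ) := by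
  have hr : Computable fun n => some (f n, n + 1) :=
    Computable.option_some.comp (Computable.pair hf Computable.succ)
  obtain ⟨U, hU, h⟩ := exists_machine hr tsum_mass_succ.le b
  exact ⟨U, hU, fun n => (h _ _).2 ⟨n + 1, le_rfl, n, rfl⟩⟩

/-! ### Minimal functions, optimal and universal machines -/

/-- Hence a string of length `s` is not among those considered at stage `s`. -/
theorem length_le_encode (x : Str) : x.length ≤ Encodable.encode x := by
  induction x with
  | nil => simp
  | cons a x ih =>
    rw [Encodable.encode_list_cons, List.length_cons]
    exact Nat.succ_le_succ (ih.trans (Nat.right_le_pair _ _))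

/-- If the sum were `1`, one could compute a stage at which it visibly exceeds `1 - 2 ^ (-m)`, and
every string not yet considered would have value above `m`. This gives computable strings of large
value, against minimality. -/
theorem tsum_weight_lt_one {K : Str → ℕ∞} (hK : K ∈ minimalFunctions semimeasureClass) :
    ∑' x, weight (K x) < 1 := by
  obtain ⟨⟨hK, h1⟩, hmin⟩ := hK
  refine h1.lt_of_ne fun heq => ?_
  obtain ⟨k, hk⟩ := upperSemicomputable_iff.1 hK
  -- The threshold `2 * n + 2` is chosen to exceed `n + 1 + c` at `n = c`, where `c` is the constant
  -- from minimality.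
  have hex (n : ℕ) : ∃ s, decide (NearlyOne k s (2 * n + 2)) = true := by
    obtain ⟨s, hs⟩ := (hk.eventually_nearlyOne heq (2 * n + 2)).exists
    exact ⟨s, by simpa using hs⟩
  have hc : Computable₂ fun n s => decide (NearlyOne k s (2 * n + 2)) :=
    (computable_nearlyOne hk.computable).comp Computable.snd
      ((Primrec.succ.comp Primrec.nat_double_succ).to_comp.comp Computable.fst)
  have hf : Computable fun n => List.replicate (Nat.find (hex n)) false :=
    primrec_replicate.to_comp.comp (computable_find hc hex)
  obtain ⟨V, hV, h2⟩ := exists_machine_KS_le hf true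
  obtain ⟨c, hc⟩ := hmin _ (KS_mem_semimeasureClass hV)
  have h3 : NearlyOne k (Nat.find (hex c)) (2 * c + 2) := by simpa using Nat.find_spec (hex c)
  have h4 := h3.lt hk h1 (x := List.replicate (Nat.find (hex c)) false)
    (by simpa using length_le_encode (List.replicate (Nat.find (hex c)) false))
  have h5 := h4.trans_le ((hc _).trans (add_le_add (h2 c) le_rfl))
  norm_cast at h5
  omega

/-- The enumeration that combines `e` and `e'`. -/
def combine (e e' : ℕ → Option (Str × Str)) (i : ℕ) : Option (Str × Str) :=
  if i.unpair.1 = 0 then e i.unpair.2 else e' i.unpair.2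

theorem computable_combine {e e' : ℕ → Option (Str × Str)} (he : Computable e)
    (he' : Computable e') : Computable (combine e e') :=
  computable_ite (c := fun i : ℕ => i.unpair.1 = 0)
    (Primrec.eq.decide.to_comp.comp (Computable.fst.comp Computable.unpair) (Computable.const 0))
    (he.comp (Computable.snd.comp Computable.unpair))
    (he'.comp (Computable.snd.comp Computable.unpair))

theorem mem_rangeOf_combine {e e' : ℕ → Option (Str × Str)} {y : Str × Str} :
    y ∈ rangeOf (combine e e') ↔ y ∈ rangeOf e ∨ y ∈ rangeOf e' := by
  constructor
  · rintro ⟨i, hi⟩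
    rw [combine] at hi
    split_ifs at hi
    exacts [Or.inl ⟨_, hi⟩, Or.inr ⟨_, hi⟩]
  · rintro (⟨i, hi⟩ | ⟨i, hi⟩)
    · exact ⟨Nat.pair 0 i, by simp [combine, hi]⟩
    · exact ⟨Nat.pair 1 i, by simp [combine, hi]⟩

/-- The enumeration `e` with `v` added to all the descriptions. -/
def prepend (v : Str) (e : ℕ → Option (Str × Str)) (i : ℕ) : Option (Str × Str) :=
  (e i).map fun y => (v ++ y.1, y.2)

theorem computable_prepend (v : Str) {e : ℕ → Option (Str × Str)} (he : Computable e) :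
    Computable (prepend v e) := by
  refine Computable.option_map he ?_
  exact Computable.pair (Computable.list_append.comp (Computable.const v)
    (Computable.fst.comp Computable.snd)) (Computable.snd.comp Computable.snd)

theorem mem_rangeOf_prepend {v : Str} {e : ℕ → Option (Str × Str)} {p x : Str} :
    (p, x) ∈ rangeOf (prepend v e) ↔ ∃ q, p = v ++ q ∧ (q, x) ∈ rangeOf e := by
  constructor
  · rintro ⟨i, hi⟩
    simp only [prepend, Option.map_eq_some_iff, Prod.mk.injEq] at hi
    obtain ⟨⟨q, y⟩, h1, rfl, rfl⟩ := hi
    exact ⟨q, rfl, _, h1⟩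
  · rintro ⟨q, rfl, i, hi⟩
    exact ⟨i, by simp [prepend, hi]⟩

/-- The gap below `1` leaves room for a string `v` incomparable with all descriptions that realise
`K`. The cone of `v` makes the machine universal; as `v` has length at least `c`, the descriptions
in it are never shorter than `K` requires. -/
theorem exists_universal {b : Bool} {K : Str → ℕ∞}
    (hK : K ∈ minimalFunctions semimeasureClass) :
    ∃ U, Universal (MachineClass b) U ∧ KS U = K := by
  have hu := consistent_universalEnum b
  have hU₀ : MachineClass b (enumMachine b (universalEnum b)) :=
    machineClass_enumMachine (computable_universalEnum b) hu
  obtain ⟨c, hc⟩ := hK.2 _ (KS_mem_semimeasureClass hU₀)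
  obtain ⟨r, hr, h1, -, h2⟩ := exists_requests hK.1
  obtain ⟨d, hd, h3⟩ := exists_mass_add_le (h2 (tsum_weight_lt_one hK)) c
  obtain ⟨w, e, hw, he, h4, h5, h6⟩ := exists_enumeration hr (o := some d) h3
  obtain ⟨v, rfl, hv⟩ := Option.map_eq_some_iff.1 hw
  replace h4 := h4 v rfl
  set E := combine e (prepend v (universalEnum b)) with hE
  have hEc : Computable E :=
    computable_combine he (computable_prepend v (computable_universalEnum b))
  have hmem {p x : Str} : (p, x) ∈ rangeOf E ↔ (p, x) ∈ rangeOf e ∨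
      ∃ q, p = v ++ q ∧ (q, x) ∈ rangeOf (universalEnum b) := by
    rw [hE, mem_rangeOf_combine, mem_rangeOf_prepend]
  have hcons : Consistent b (rangeOf E) := by
    rintro ⟨p, x⟩ hp ⟨p', x'⟩ hp' hpp
    rcases hmem.1 hp with hp | ⟨q, rfl, hq⟩ <;> rcases hmem.1 hp' with hp' | ⟨q', rfl, hq'⟩
    · exact h5 b _ hp _ hp' hpp
    · exact absurd hpp ((h4 _ hp).extend_left (List.prefix_append _ _)).2
    · exact absurd hpp ((h4 _ hp').extend_left (List.prefix_append _ _)).1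
    · have := hu _ hq _ hq' ((List.prefix_append_right_inj v).1 hpp)
      exact ⟨this.1.append_left v, this.2⟩
  refine ⟨enumMachine b E, ⟨machineClass_enumMachine hEc hcons, fun V hV => ?_⟩, ?_⟩
  · obtain ⟨n, hn⟩ := exists_universalEnum hV
    refine ⟨v ++ unary n, fun x => Part.ext fun z => ?_⟩
    rw [mem_enumMachine hcons, hn, List.append_assoc]
    constructor
    · rintro ⟨p, hp, hz⟩
      rcases hmem.1 hz with hz | ⟨q, rfl, hq⟩
      · exact absurd hp.1 ((h4 _ hz).extend_left (List.prefix_append _ _)).2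
      · exact ⟨q, matches_append_left_iff.1 hp, hq⟩
    · rintro ⟨q, hq, hz⟩
      exact ⟨v ++ q, hq.append_left v, hmem.2 (Or.inr ⟨q, rfl, hz⟩)⟩
  · refine funext fun x => enat_ext fun m => ?_
    rw [KS_enumMachine_le_iff hcons, h1]
    constructor
    · rintro ⟨p, hp, hm⟩
      rcases hmem.1 hp with hp | ⟨q, rfl, hq⟩
      · exact ⟨_, hm, (h6 _ _).2 ⟨p, rfl, hp⟩⟩
      -- A description `v ++ q` has length at least `c + KS x` for the universal machine, hence at
      -- least `K x`: it gives nothing better than `K`.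
      · have h7 : KS (enumMachine b (universalEnum b)) x ≤ q.length :=
          (KS_enumMachine_le_iff hu).2 ⟨q, hq, le_rfl⟩
        refine (h1 x m).1 ((hc x).trans ((add_le_add h7 le_rfl).trans ?_))
        rw [List.length_append] at hm
        exact_mod_cast (by omega : q.length + c ≤ m)
    · rintro ⟨k, hk, hx⟩
      obtain ⟨q, rfl, hq⟩ := (h6 _ _).1 hx
      exact ⟨q, hmem.2 (Or.inl hq), hk⟩

theorem Universal.optimal {M : Machine → Prop} {U : Machine} (h : Universal M U) :
    Optimal M U := by
  refine ⟨h.1, fun V hV => ?_⟩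
  obtain ⟨v, hv⟩ := h.2 V hV
  refine ⟨v.length, fun x => ?_⟩
  cases hx : KS V x with
  | top => simp
  | coe m =>
    obtain ⟨p, hp, hm⟩ := KS_le_iff.1 hx.le
    have : KS U x ≤ (m + v.length : ℕ) :=
      KS_le_iff.2 ⟨v ++ p, by rwa [hv], by rw [List.length_append]; omega⟩
    exact_mod_cast this

theorem complexities_optimal_subset (b : Bool) :
    complexities (Optimal (MachineClass b)) ⊆ minimalFunctions semimeasureClass := by
  rintro K ⟨U, hU, rfl⟩
  refine ⟨KS_mem_semimeasureClass hU.1, fun K' hK' => ?_⟩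
  rw [← complexities_machineClass b] at hK'
  obtain ⟨V, hV, rfl⟩ := hK'
  exact hU.2 V hV

theorem complexities_universal_optimal (b : Bool) :
    complexities (Universal (MachineClass b)) = complexities (Optimal (MachineClass b)) ∧
      complexities (Optimal (MachineClass b)) = minimalFunctions semimeasureClass := by
  have h1 : complexities (Universal (MachineClass b)) ⊆
      complexities (Optimal (MachineClass b)) := fun K ⟨U, hU, h⟩ => ⟨U, hU.optimal, h⟩
  have h2 := complexities_optimal_subset b
  have h3 : minimalFunctions semimeasureClass ⊆ complexities (Universal (MachineClass b)) :=
    fun K hK => exists_universal hK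
  exact ⟨h1.antisymm (h2.trans h3), h2.antisymm (h3.trans h1)⟩

/-! ### Integer-valued functions -/

theorem primrec_toNat : Primrec Int.toNat := by
  refine Primrec.ofNat_iff.2 ?_
  -- In the coding of `ℤ`, the natural number `n` has the even code `2 * n`, and negative integers
  -- have odd codes.
  have h : Primrec fun n : ℕ => if n.bodd = false then n.div2 else 0 :=
    Primrec.ite (Primrec.eq.comp Primrec.nat_bodd (Primrec.const false)) Primrec.nat_div2
      (Primrec.const 0)
  refine h.of_eq fun n => ?_
  change _ = (Equiv.intEquivNat.symm n).toNat
  cases hn : n.bodd <;>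
    simp [Equiv.intEquivNat, Equiv.natSumNatEquivNat, Equiv.intEquivNatSumNat,
      Equiv.boolProdNatEquivNat, hn]

theorem primrec_intCast : Primrec fun n : ℕ => (n : ℤ) := by
  refine Primrec.encode_iff.1 (Primrec.nat_double.of_eq fun n => ?_)
  change _ = Equiv.intEquivNat (n : ℤ)
  rfl

theorem mem_intComplexities_iff {M : Machine → Prop} {K : Str → ℤ} :
    K ∈ intComplexities M ↔
      ∃ L : Str → ℕ, (K = fun x => (L x : ℤ)) ∧ (fun x => (L x : ℕ∞)) ∈ complexities M := by
  constructor
  · rintro ⟨U, hU, h⟩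
    have hnn (x : Str) : ((K x).toNat : ℤ) = K x := by
      obtain ⟨p, -, hp⟩ := (h x).1
      omega
    refine ⟨fun x => (K x).toNat, funext fun x => (hnn x).symm, U, hU, funext fun x => ?_⟩
    obtain ⟨p, hx, hp⟩ := (h x).1
    refine enat_ext fun m => KS_le_iff.trans ⟨?_, fun hm => ⟨p, hx, ?_⟩⟩
    · rintro ⟨q, hq, hm⟩
      have := (h x).2 ⟨q, hq, rfl⟩
      exact_mod_cast (by omega : (K x).toNat ≤ m)
    · have hm : (K x).toNat ≤ m := by exact_mod_cast hm
      omega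
  · rintro ⟨L, rfl, U, hU, h⟩
    refine ⟨U, hU, fun x => ?_⟩
    have hx : KS U x = (L x : ℕ∞) := congrFun h x
    obtain ⟨p, hp, hl⟩ := KS_le_iff.1 hx.le
    have hmin (q : Str) (hq : x ∈ U q) : L x ≤ q.length := by
      have := KS_le_iff.2 ⟨q, hq, le_rfl⟩
      rw [hx] at this
      exact_mod_cast this
    refine ⟨⟨p, hp, ?_⟩, ?_⟩
    · exact congrArg Nat.cast (le_antisymm hl (hmin p hp))
    · rintro n ⟨q, hq, rfl⟩
      exact Int.ofNat_le.2 (hmin q hq)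

theorem two_zpow_neg_natCast (n : ℕ) : (2 : ℝ≥0∞) ^ (-(n : ℤ)) = mass n := by
  rw [ENNReal.zpow_neg, zpow_natCast, mass, ENNReal.inv_pow]

/-- From `ℤ` to `ℕ∞`, truncation at `0` is harmless because the approximations stay above `L`.
Conversely, the approximation at `x` is started at the first stage where it is finite, which can be
found by search as `L x` is finite; monotonicity keeps it finite. -/
theorem upperSemicomputable_natCast_iff {L : Str → ℕ} :
    UpperSemicomputable (fun x => (L x : ℤ)) ↔ UpperSemicomputable fun x => (L x : ℕ∞) := by
  constructor
  · rintro ⟨k, h1, h2, h3⟩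
    have hle (n : ℕ) (x : Str) : (L x : ℤ) ≤ k n x := (h2 x).le_of_tendsto (h3 x) n
    refine upperSemicomputable_iff.2 ⟨fun n x => ((k n x).toNat : ℕ∞), ?_, fun n x => ?_,
      fun x m n hmn => ?_, fun x => ?_⟩
    · exact (primrec_ofOption.comp Primrec.option_some).to_comp.comp
        (primrec_toNat.to_comp.comp h1)
    · have := hle n x
      exact_mod_cast (by omega : L x ≤ (k n x).toNat)
    · have : k n x ≤ k m x := h2 x hmn
      exact Nat.cast_le.2 (by omega : (k n x).toNat ≤ (k m x).toNat)
    · have h4 := h3 x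
      rw [nhds_discrete, tendsto_pure] at h4
      filter_upwards [h4] with n hn
      simp [hn]
  · intro h
    obtain ⟨k, hk⟩ := upperSemicomputable_iff.1 h
    have hex (x : Str) : ∃ n, (finiteValue (k n x)).isSome = true := by
      obtain ⟨n, hn⟩ := (hk.eventually x).exists
      exact ⟨n, by simp [hn]⟩
    have hfin (x : Str) (n : ℕ) :
        k (Nat.find (hex x) + n) x = ((finiteValue (k (Nat.find (hex x) + n) x)).getD 0 : ℕ) := by
      obtain ⟨m, hm⟩ := Option.isSome_iff_exists.1 (Nat.find_spec (hex x))
      have h1 : k (Nat.find (hex x) + n) x ≤ m :=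
        (hk.antitone x (Nat.le_add_right _ _)).trans (finiteValue_eq_some.1 hm).le
      obtain ⟨j, hj⟩ := ENat.ne_top_iff_exists.1 (ne_top_of_le_ne_top (ENat.natCast_ne_top m) h1)
      rw [← hj]
      simp
    refine ⟨fun n x => ((finiteValue (k (Nat.find (hex x) + n) x)).getD 0 : ℕ), ?_,
      fun x m n hmn => ?_, fun x => ?_⟩
    · have h1 : Computable₂ fun (x : Str) (n : ℕ) => (finiteValue (k n x)).isSome :=
        Primrec.option_isSome.to_comp.comp (primrec_finiteValue.to_comp.comp
          (hk.computable.comp Computable.snd Computable.fst))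
      have h2 : Computable fun a : ℕ × Str => k (Nat.find (hex a.2) + a.1) a.2 :=
        hk.computable.comp (Primrec.nat_add.to_comp.comp
          ((computable_find h1 hex).comp Computable.snd) Computable.fst) Computable.snd
      exact primrec_intCast.to_comp.comp (Computable.option_getD
        (primrec_finiteValue.to_comp.comp h2) (Computable.const 0))
    · have := hk.antitone x (Nat.add_le_add_left hmn (Nat.find (hex x)))
      simp only [] at this
      rw [hfin, hfin x m] at this
      exact Int.ofNat_le.2 (Nat.cast_le.1 this)
    · refine tendsto_const_nhds.congr' ?_
      obtain ⟨N, hN⟩ := eventually_atTop.1 (hk.eventually x)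
      filter_upwards [eventually_ge_atTop N] with n hn
      rw [hN _ (hn.trans (Nat.le_add_left _ _))]
      simp

theorem mem_intSemimeasureClass_iff {K : Str → ℤ} :
    K ∈ intSemimeasureClass ↔
      ∃ L : Str → ℕ, (K = fun x => (L x : ℤ)) ∧ (fun x => (L x : ℕ∞)) ∈ semimeasureClass := by
  have hcast (L : Str → ℕ) : (fun x => (L x : ℤ)) ∈ intSemimeasureClass ↔
      (fun x => (L x : ℕ∞)) ∈ semimeasureClass := by
    simp only [intSemimeasureClass, semimeasureClass, Set.mem_ofPred_eq, two_zpow_neg_natCast,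
      weight_coe, upperSemicomputable_natCast_iff]
  constructor
  · intro hK
    -- A negative value would by itself contribute more than `1` to the sum.
    have hnn (x : Str) : ((K x).toNat : ℤ) = K x := by
      have h1 : (2 : ℝ≥0∞) ^ (-K x) ≤ 1 := (ENNReal.le_tsum x).trans hK.2
      by_contra h
      obtain ⟨n, hn⟩ : ∃ n : ℕ, -K x = (n + 1 : ℕ) := ⟨(-K x).toNat - 1, by omega⟩
      rw [hn, zpow_natCast] at h1
      exact absurd h1 (not_le.2 (one_lt_pow₀ ENNReal.one_lt_two (by simp)))
    have hL : K = fun x => ((K x).toNat : ℤ) := funext fun x => (hnn x).symm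
    exact ⟨fun x => (K x).toNat, hL, (hcast _).1 (hL ▸ hK)⟩
  · rintro ⟨L, rfl, hL⟩
    exact (hcast L).2 hL

theorem intComplexities_machineClass (b : Bool) :
    intComplexities (MachineClass b) = intSemimeasureClass := by
  ext K
  rw [mem_intComplexities_iff, mem_intSemimeasureClass_iff, complexities_machineClass]

/-! ### Minimal descriptions -/

/-- The shortest prefix of `p` in the domain works: by stability its value is also the value at `p`.
-/
theorem PrefixStable.exists_isMinimalDescription {U : Machine} (hU : PrefixStable U) {p x : Str}
    (hx : x ∈ U p) : ∃ q, q <+: p ∧ IsMinimalDescription U q x := by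
  classical
  have hex : ∃ j, (U (p.take j)).Dom :=
    ⟨p.length, by rw [List.take_length]; exact Part.dom_iff_mem.2 ⟨x, hx⟩⟩
  refine ⟨p.take (Nat.find hex), List.take_prefix _ _, ?_, fun q hq hdom => ?_⟩
  · obtain ⟨y, hy⟩ := Part.dom_iff_mem.1 (Nat.find_spec hex)
    rwa [Part.mem_unique hx (hU.2 _ p y hy (List.take_prefix _ _))]
  · have h1 := List.prefix_iff_eq_take.1 (hq.trans (List.take_prefix _ _))
    have h2 : Nat.find hex ≤ q.length := Nat.find_min' hex (h1 ▸ hdom)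
    exact hq.eq_of_length_le ((List.length_take_le _ _).trans h2)

/-- The object of the first of two pairs, if the objects are different and the descriptions have
the same prefix of length `n`. -/
def splitObject (n : ℕ) (o o' : Option (Str × Str)) : Option Str :=
  o.bind fun y => o'.bind fun z =>
    if y.1.take n = z.1.take n ∧ y.2 ≠ z.2 then some y.2 else none

theorem splitObject_eq_some {n : ℕ} {o o' : Option (Str × Str)} {x : Str} :
    splitObject n o o' = some x ↔ ∃ p q z, o = some (p, x) ∧ o' = some (q, z) ∧
      p.take n = q.take n ∧ x ≠ z := by
  simp only [splitObject, Option.bind_eq_some_iff, Option.ite_none_right_eq_some,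
    Option.some.injEq]
  constructor
  · rintro ⟨⟨p, x⟩, h1, ⟨q, z⟩, h2, ⟨h3, h4⟩, rfl⟩
    exact ⟨p, q, z, h1, h2, h3, h4⟩
  · rintro ⟨p, q, z, h1, h2, h3, h4⟩
    exact ⟨(p, x), h1, (q, z), h2, ⟨h3, h4⟩, rfl⟩

theorem primrec_splitObject :
    Primrec fun a : ℕ × Option (Str × Str) × Option (Str × Str) =>
      splitObject a.1 a.2.1 a.2.2 := by
  have h1 : PrimrecPred fun a : ((ℕ × Option (Str × Str) × Option (Str × Str)) × Str × Str) ×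
      Str × Str => a.1.2.1.take a.1.1.1 = a.2.1.take a.1.1.1 ∧ a.1.2.2 ≠ a.2.2 := by
    have hn : Primrec fun a : ((ℕ × Option (Str × Str) × Option (Str × Str)) × Str × Str) ×
        Str × Str => a.1.1.1 := Primrec.fst.comp (Primrec.fst.comp Primrec.fst)
    refine PrimrecPred.and (Primrec.eq.comp (Primrec.list_take.comp hn
      (Primrec.fst.comp (Primrec.snd.comp Primrec.fst)))
      (Primrec.list_take.comp hn (Primrec.fst.comp Primrec.snd))) (PrimrecPred.not
        (Primrec.eq.comp (Primrec.snd.comp (Primrec.snd.comp Primrec.fst))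
          (Primrec.snd.comp Primrec.snd)))
  have h2 := Primrec.ite h1 (Primrec.option_some.comp (Primrec.snd.comp
    (Primrec.snd.comp Primrec.fst))) (Primrec.const none)
  refine Primrec.option_bind (Primrec.fst.comp Primrec.snd) ?_
  exact Primrec.option_bind (Primrec.snd.comp (Primrec.snd.comp Primrec.fst)) h2.to₂

/-- Comparison with a machine that describes every string, the one with code `n` by `n + 1` bits. -/
theorem Optimal.exists_description {b : Bool} {U : Machine} (hU : Optimal (MachineClass b) U)
    (x : Str) : ∃ p, x ∈ U p := by
  have hf : Computable fun n => (Encodable.decode (α := Str) n).getD [] :=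
    Computable.option_getD Computable.decode (Computable.const [])
  obtain ⟨V, hV, h⟩ := exists_machine_KS_le hf b
  obtain ⟨c, hc⟩ := hU.2 V hV
  have h1 := h (Encodable.encode x)
  rw [Encodable.encodek, Option.getD_some] at h1
  have h2 : KS U x ≤ (Encodable.encode x + 1 + c : ℕ) := by
    push_cast at h1 ⊢
    exact (hc x).trans (add_le_add h1 le_rfl)
  obtain ⟨p, hp, -⟩ := KS_le_iff.1 h2
  exact ⟨p, hp⟩

theorem exists_incomparable_isMinimalDescription {U : Machine} (hU : Optimal PrefixStable U) :
    ∃ x p q : Str, IsMinimalDescription U p x ∧ IsMinimalDescription U q x ∧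
      ¬ p <+: q ∧ ¬ q <+: p := by
  have hb : Optimal (MachineClass false) U := hU
  obtain ⟨N, hN⟩ := exists_rangeOf_graphEnum hU.1.1
  have hex (n : ℕ) : ∃ t : ℕ, (splitObject (2 * n + 2) (graphEnum N t.unpair.1)
      (graphEnum N t.unpair.2)).isSome = true := by
    choose p hp using hb.exists_description
    have hfin : Finite {w : Str // w.length ≤ 2 * n + 2} :=
      (List.finite_length_le Bool (2 * n + 2)).to_subtype
    -- Pigeonhole: infinitely many objects, finitely many prefixes of length at most `2 * n + 2`.
    obtain ⟨x, y, hxy, h⟩ := Finite.exists_ne_map_eq_of_infinite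
      fun x : Str => (⟨(p x).take (2 * n + 2), by simp⟩ : {w : Str // w.length ≤ 2 * n + 2})
    have hx : (p x, x) ∈ rangeOf (graphEnum N) := by rw [hN]; exact hp x
    have hy : (p y, y) ∈ rangeOf (graphEnum N) := by rw [hN]; exact hp y
    obtain ⟨i, hi⟩ := hx
    obtain ⟨j, hj⟩ := hy
    refine ⟨Nat.pair i j, Option.isSome_iff_exists.2 ⟨x, ?_⟩⟩
    rw [Nat.unpair_pair]
    exact splitObject_eq_some.2 ⟨_, _, y, hi, hj, congrArg Subtype.val h, hxy⟩
  have hg : Computable (graphEnum N) := computable_graphEnum.comp (Computable.const N) Computable.id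
  have hs : Computable₂ fun n t : ℕ => splitObject (2 * n + 2) (graphEnum N t.unpair.1)
      (graphEnum N t.unpair.2) := by
    refine primrec_splitObject.to_comp.comp (Computable.pair
      ((Primrec.succ.comp Primrec.nat_double_succ).to_comp.comp Computable.fst)
      (Computable.pair (hg.comp ?_) (hg.comp ?_)))
    · exact Computable.fst.comp (Computable.unpair.comp Computable.snd)
    · exact Computable.snd.comp (Computable.unpair.comp Computable.snd)
  have hf := Computable.option_getD (hs.comp Computable.id
    (computable_find (Primrec.option_isSome.to_comp.comp hs).to₂ hex)) (Computable.const [])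
  obtain ⟨V, hV, h1⟩ := exists_machine_KS_le hf false
  obtain ⟨c, hc⟩ := hU.2 V hV
  obtain ⟨x, hx⟩ := Option.isSome_iff_exists.1 (Nat.find_spec (hex c))
  have h2 := h1 c
  simp only [id, hx, Option.getD_some] at h2
  -- At `n = c` the computed object `x` has complexity at most `2 * c + 1`, within the length of the
  -- shared prefix.
  have h3 : KS U x ≤ (2 * c + 2 : ℕ) := by
    refine (hc x).trans ((add_le_add h2 le_rfl).trans ?_)
    exact_mod_cast (by omega : c + 1 + c ≤ 2 * c + 2)
  obtain ⟨u, hu, hul⟩ := KS_le_iff.1 h3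
  obtain ⟨p, q, z, hp, hq, hpq, hxz⟩ := splitObject_eq_some.1 hx
  have hpU : (p, x) ∈ graph U := by rw [← hN]; exact ⟨_, hp⟩
  have hqU : (q, z) ∈ graph U := by rw [← hN]; exact ⟨_, hq⟩
  obtain ⟨p', hp', hpm⟩ := hU.1.exists_isMinimalDescription hpU
  obtain ⟨u', hu', hum⟩ := hU.1.exists_isMinimalDescription hu
  -- A common minimal description would be short enough to lie in the prefix shared by `p` and `q`,
  -- so by stability `q` would describe `x` besides `z`. Distinct minimal descriptions are
  -- incomparable, each being minimal in the domain.
  have hne : p' ≠ u' := by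
    rintro rfl
    have h4 : p' <+: p.take (2 * c + 2) :=
      List.prefix_take_iff.2 ⟨hp', hu'.length_le.trans hul⟩
    rw [hpq] at h4
    exact hxz (Part.mem_unique (hU.1.2 _ q x hpm.1 (h4.trans (List.take_prefix _ _))) hqU)
  exact ⟨x, p', u', hpm, hum, fun h => hne (hum.2 _ h (Part.dom_iff_mem.2 ⟨x, hpm.1⟩)),
    fun h => hne (hpm.2 _ h (Part.dom_iff_mem.2 ⟨x, hum.1⟩)).symm⟩

end PrefixComplexity

open PrefixComplexity in
theorem proposition2 :
    -- (a), where the value `∞` is allowed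
    (complexities PrefixStable = complexities PrefixFree ∧
      complexities PrefixFree = semimeasureClass) ∧
    -- (a) for functions with finite integer values only
    (intComplexities PrefixStable = intComplexities PrefixFree ∧
      intComplexities PrefixFree = intSemimeasureClass) ∧
    -- (b) for prefix-free machines
    (complexities (Universal PrefixFree) = complexities (Optimal PrefixFree) ∧
      complexities (Optimal PrefixFree) = minimalFunctions semimeasureClass) ∧
    -- (b) for prefix-stable machines
    (complexities (Universal PrefixStable) = complexities (Optimal PrefixStable) ∧
      complexities (Optimal PrefixStable) = minimalFunctions semimeasureClass) ∧
    -- the lemma on optimal prefix-stable machines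
    (∀ U : Machine, Optimal PrefixStable U →
      ∃ x p q : Str, IsMinimalDescription U p x ∧ IsMinimalDescription U q x ∧
        ¬ p <+: q ∧ ¬ q <+: p) := by
  refine ⟨⟨?_, complexities_machineClass true⟩, ⟨?_, intComplexities_machineClass true⟩,
    complexities_universal_optimal true, complexities_universal_optimal false,
    fun U hU => exists_incomparable_isMinimalDescription hU⟩
  · exact (complexities_machineClass false).trans (complexities_machineClass true).symm
  · exact (intComplexities_machineClass false).trans (intComplexities_machineClass true).symm
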